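/- Let $\Sigma$ be a finite, non-empty, totally ordered alphabet and $w\ge 1$. A $(\Sigma,w)$-layer is a tuple $(\ell,r,T,I,F,\iota,\phi)$ with left states $\ell\subseteq\{0,\dots,w-1\}$, right states $r\subseteq\{0,\dots,w-1\}$, transitions $T\subseteq \ell\times\Sigma\times r$, initial states $I\subseteq \ell$, final states $F\subseteq r$ and Boolean flags $\iota,\phi$ such that $I=\emptyset$ if $\iota=0$ and $F=\emptyset$ if $\phi=0$. A $(\Sigma,w)$-ODD of length $k\ge 1$ is a string $D=L_1\cdots L_k$ of $(\Sigma,w)$-layers with $\ell(L_{i+1})=r(L_i)$ for $1\le i<k$, with $\iota(L_i)=1$ exactly for $i=1$, and with $\phi(L_i)=1$ exactly for $i=k$. It accepts $a_1\cdots a_k\in\Sigma^k$ if there are states $q_0,\dots,q_k$ with $q_0\in I(L_1)$, $q_k\in F(L_k)$ and $(q_{i-1},a_i,q_i)\in T(L_i)$ for all $1\le i\le k$; its language $\mathcal L(D)$ is the pair of $k$ and the set of accepted strings. The width of $D$ is $\max\{|\ell(L_1)|,\dots,|\ell(L_k)|,|r(L_k)|\}$, its number of states is $|\ell(L_1)|+\sum_{i=1}^k|r(L_i)|$,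 and its number of transitions is $\sum_{i=1}^k|T(L_i)|$. For a set $S$ of $(\Sigma,w)$-layers, let $S^{\circ k}$ be the set of ODDs of length $k$ all of whose layers are in $S$, and $S^{\circledast}=\bigcup_{k\ge1}S^{\circ k}$. There are four algorithms, each uniform in all the data, with the following properties for every $\Sigma$, $w\ge1$, $k\ge1$, every $(\Sigma,w)$-ODD $D$ of length $k$ and every set $S$ of $(\Sigma,w)$-layers. The input consists of $|\Sigma|$, $w$, $D$ and a list, in any order and without repetition, of the elements of $S$. The constants hidden in $O(\cdot)$ are absolute. Time is the number of elementary steps (building a cell, following a pointer, testing for nil, accessing a variable, branching, binding a variable, calling a function) of a first-order recursive program on binary trees. The first algorithm decides in time $2^{O(|\Sigma|\cdot w\cdot 2^w)}\cdot k$ whether there is $D'\in S^{\circ k}$ with $\mathcal L(D')=\mathcal L(D)$. Whenever such a $D'$ exists: 1. the second algorithm constructs in time $2^{O(|\Sigma|\cdot w\cdot 2^w)}\cdot k$ an ODD of minimum width among all $D'\in S^{\circledast}$ with $\mathcal L(D')=\mathcal L(D)$; 2. the third algorithm constructs in time $2^{O(|\Sigma|\cdot w\cdot 2^w)}\cdot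 k^2\lfloor\log_2(k+1)\rfloor$ an ODD with minimum number of states among all $D'\in S^{\circledast}$ with $\mathcal L(D')=\mathcal L(D)$; 3. the fourth algorithm constructs in time $2^{O(|\Sigma|\cdot w\cdot 2^w)}\cdot k^2\lfloor\log_2(k+1)\rfloor$ an ODD with minimum number of transitions among all $D'\in S^{\circledast}$ with $\mathcal L(D')=\mathcal L(D)$. -/

import Mathlib

universe u

namespace ODD

/-! ### Layers and ordered decision diagrams -/

/-- A layer of width at most `w` over the alphabet `α`; its states are elements of
`{0, …, w - 1}`. -/
@[ext]
structure Layer (α : Type*) (w : ℕ) where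
  /-- left states -/
  left : Finset (Fin w)
  /-- right states -/
  right : Finset (Fin w)
  /-- transitions -/
  trans : Finset (Fin w × α × Fin w)
  /-- initial states -/
  init : Finset (Fin w)
  /-- final states -/
  fin : Finset (Fin w)
  initFlag : Bool
  finFlag : Bool
  trans_sub : ∀ e ∈ trans, e.1 ∈ left ∧ e.2.2 ∈ right
  init_sub : init ⊆ left
  fin_sub : fin ⊆ right
  init_flag : initFlag = false → init = ∅
  fin_flag : finFlag = false → fin = ∅

/-- A nonempty string of layers is an ordered decision diagram when consecutive layers share
their frontier, exactly the first layer has its initial flag set, and exactly the last layer has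
its final flag set. -/
structure IsODD {α : Type*} {w : ℕ} (D : List (Layer α w)) : Prop where
  ne_nil : D ≠ []
  frontier : D.IsChain (fun L L' => L'.left = L.right)
  initFlag : ∀ (i : ℕ) (h : i < D.length), D[i].initFlag = true ↔ i = 0
  finFlag : ∀ (i : ℕ) (h : i < D.length), D[i].finFlag = true ↔ i + 1 = D.length

/-- The ordered decision diagrams of length `k` all of whose layers belong to `S`. -/
def oddsOfLength {α : Type*} {w : ℕ} (S : Set (Layer α w)) (k : ℕ) : Set (List (Layer α w)) :=
  {D | IsODD D ∧ D.length = k ∧ ∀ L ∈ D, L ∈ S}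

/-- The ordered decision diagrams, of any length, all of whose layers belong to `S`. -/
def odds {α : Type*} {w : ℕ} (S : Set (Layer α w)) : Set (List (Layer α w)) :=
  {D | ∃ k : ℕ, 0 < k ∧ D ∈ oddsOfLength S k}

/-- `r` is an accepting sequence of transitions for the string `s` in `D`. -/
structure IsAccepting {α : Type*} {w : ℕ} (D : List (Layer α w)) (s : List α)
    (r : List (Fin w × α × Fin w)) : Prop where
  trans : List.Forall₂ (fun e L => e ∈ L.trans) r D
  letters : r.map (fun e => e.2.1) = s
  linked : r.IsChain (fun e e' => e'.1 = e.2.2)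
  initial : ∃ e ∈ r.head?, ∃ L ∈ D.head?, e.1 ∈ L.init
  final : ∃ e ∈ r.getLast?, ∃ L ∈ D.getLast?, e.2.2 ∈ L.fin

/-- The language of `D`, as a set of strings typed with their length. -/
def lang {α : Type*} {w : ℕ} (D : List (Layer α w)) : ℕ × Set (List α) :=
  (D.length, {s | ∃ r, IsAccepting D s r})

/-- The width: the maximum size of a left frontier or of the last right frontier. -/
def width {α : Type*} {w : ℕ} (D : List (Layer α w)) : ℕ :=
  max ((D.map fun L => L.left.card).foldr max 0) ((D.getLast?.map fun L => L.right.card).getD 0)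

/-- The number of states: the first left frontier together with all right frontiers. -/
def numStates {α : Type*} {w : ℕ} (D : List (Layer α w)) : ℕ :=
  (D.head?.map fun L => L.left.card).getD 0 + (D.map fun L => L.right.card).sum

/-- The number of transitions. -/
def numTransitions {α : Type*} {w : ℕ} (D : List (Layer α w)) : ℕ :=
  (D.map fun L => L.trans.card).sum

/-- Among the diagrams with layers in `S` and the same language as `D`, the diagram `D'` minimizes
the measure `μ`. -/
def IsMinimizer {α : Type*} {w : ℕ} (μ : List (Layer α w) → ℕ) (S : Set (Layer α w))
    (D D' : List (Layer α w)) : Prop :=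
  D' ∈ odds S ∧ lang D' = lang D ∧ ∀ D'' ∈ odds S, lang D'' = lang D → μ D' ≤ μ D''

/-! ### The model of computation

Algorithms are first-order recursive programs manipulating binary trees of pointers: the only
primitive operations are building a cell, following one of its two pointers, and testing
whether a pointer is `nil`. There is no arithmetic: numbers have to be represented by trees and
computed with cell by cell. A program is a finite list of functions, each with one argument. -/

/-- Data: binary trees. -/
inductive Data where
  | nil : Data
  | cons (a b : Data) : Data

namespace Data

/-- The left component (`nil` has none, and yields `nil`). -/
def fst : Data → Data
  | nil => nil
  | cons a _ => a

/-- The right component (`nil` has none, and yields `nil`). -/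
def snd : Data → Data
  | nil => nil
  | cons _ b => b

/-- Truth values as data. -/
def ofBool : Bool → Data
  | false => nil
  | true => cons nil nil

/-- Lists as data. -/
def ofList : List Data → Data
  | [] => nil
  | a :: l => cons a (ofList l)

/-- Natural numbers in unary as data. -/
def ofNat (n : ℕ) : Data := ofList (List.replicate n nil)

end Data

/-- Expressions. The variable `var i` refers to the `i`-th innermost binding, the outermost
binding being the argument of the function whose body is evaluated. -/
inductive Expr where
  | var (i : ℕ) : Expr
  | nil : Expr
  | cons (a b : Expr) : Expr
  | fst (a : Expr) : Expr
  | snd (a : Expr) : Expr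
  /-- `ite c a b` evaluates `a` if `c` evaluates to a cell, and `b` if `c` evaluates to `nil` -/
  | ite (c a b : Expr) : Expr
  /-- evaluates `b` with the value of `a` as its innermost binding -/
  | letIn (a b : Expr) : Expr
  /-- calls function number `f` of the program on the value of `a` -/
  | call (f : ℕ) (a : Expr) : Expr

/-- A program is a finite list of function bodies; function number `0` is its entry point. -/
abbrev Program := List Expr

/-- `Eval P env e v t`: in the program `P`, with the bindings `env`, the expression `e` evaluates
to `v` in exactly `t` steps (call by value; every evaluation of a node of an expression is one
step). An expression whose evaluation does not terminate has no value. -/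
inductive Eval (P : Program) : List Data → Expr → Data → ℕ → Prop
  | var (env : List Data) (i : ℕ) : Eval P env (.var i) (env.getD i .nil) 1
  | nil (env : List Data) : Eval P env .nil .nil 1
  | cons {env : List Data} {a b : Expr} {u v : Data} {s t : ℕ} :
      Eval P env a u s → Eval P env b v t → Eval P env (.cons a b) (.cons u v) (s + t + 1)
  | fst {env : List Data} {a : Expr} {u : Data} {s : ℕ} :
      Eval P env a u s → Eval P env (.fst a) u.fst (s + 1)
  | snd {env : List Data} {a : Expr} {u : Data} {s : ℕ} :
      Eval P env a u s → Eval P env (.snd a) u.snd (s + 1)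
  | iteCons {env : List Data} {c a b : Expr} {x y v : Data} {s t : ℕ} :
      Eval P env c (.cons x y) s → Eval P env a v t → Eval P env (.ite c a b) v (s + t + 1)
  | iteNil {env : List Data} {c a b : Expr} {v : Data} {s t : ℕ} :
      Eval P env c .nil s → Eval P env b v t → Eval P env (.ite c a b) v (s + t + 1)
  | letIn {env : List Data} {a b : Expr} {u v : Data} {s t : ℕ} :
      Eval P env a u s → Eval P (u :: env) b v t → Eval P env (.letIn a b) v (s + t + 1)
  | call {env : List Data} {f : ℕ} {a : Expr} {u v : Data} {s t : ℕ} :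
      Eval P env a u s → Eval P [u] (P.getD f .nil) v t → Eval P env (.call f a) v (s + t + 1)

/-- Evaluation is deterministic: both the value and the number of steps are unique. -/
theorem Eval.unique {P : Program} {env : List Data} {e : Expr} {v v' : Data} {t t' : ℕ}
    (h : Eval P env e v t) (h' : Eval P env e v' t') : v = v' ∧ t = t' := by
  induction h generalizing v' t' with
  | var env i => cases h'; exact ⟨rfl, rfl⟩
  | nil env => cases h'; exact ⟨rfl, rfl⟩
  | cons _ _ ih₁ ih₂ =>
    cases h' with
    | cons h₁ h₂ =>
      obtain ⟨rfl, rfl⟩ := ih₁ h₁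
      obtain ⟨rfl, rfl⟩ := ih₂ h₂
      exact ⟨rfl, rfl⟩
  | fst _ ih => cases h' with | fst h₁ => obtain ⟨rfl, rfl⟩ := ih h₁; exact ⟨rfl, rfl⟩
  | snd _ ih => cases h' with | snd h₁ => obtain ⟨rfl, rfl⟩ := ih h₁; exact ⟨rfl, rfl⟩
  | iteCons _ _ ih₁ ih₂ =>
    cases h' with
    | iteCons h₁ h₂ =>
      obtain ⟨_, rfl⟩ := ih₁ h₁
      obtain ⟨rfl, rfl⟩ := ih₂ h₂
      exact ⟨rfl, rfl⟩
    | iteNil h₁ h₂ => exact absurd (ih₁ h₁).1 (by simp)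
  | iteNil _ _ ih₁ ih₂ =>
    cases h' with
    | iteCons h₁ h₂ => exact absurd (ih₁ h₁).1 (by simp)
    | iteNil h₁ h₂ =>
      obtain ⟨_, rfl⟩ := ih₁ h₁
      obtain ⟨rfl, rfl⟩ := ih₂ h₂
      exact ⟨rfl, rfl⟩
  | letIn _ _ ih₁ ih₂ =>
    cases h' with
    | letIn h₁ h₂ =>
      obtain ⟨rfl, rfl⟩ := ih₁ h₁
      obtain ⟨rfl, rfl⟩ := ih₂ h₂
      exact ⟨rfl, rfl⟩
  | call _ _ ih₁ ih₂ =>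
    cases h' with
    | call h₁ h₂ =>
      obtain ⟨rfl, rfl⟩ := ih₁ h₁
      obtain ⟨rfl, rfl⟩ := ih₂ h₂
      exact ⟨rfl, rfl⟩

/-- On input `x`, the program `P` terminates within `T` steps with output `y`. -/
def Program.OutputsWithin (P : Program) (x y : Data) (T : ℕ) : Prop :=
  ∃ t ≤ T, Eval P [x] (P.getD 0 .nil) y t

/-! ### Encoding of layers, diagrams and inputs -/

/-- The letters of a finite ordered alphabet, in increasing order. -/
def letters (α : Type*) [Fintype α] [LinearOrder α] : List α :=
  (Finset.univ : Finset α).sort (· ≤ ·)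

/-- A set of states, as its list of `w` membership bits. -/
def encodeStates {w : ℕ} (A : Finset (Fin w)) : Data :=
  .ofList ((List.finRange w).map fun p => .ofBool (decide (p ∈ A)))

/-- A set of transitions, as its `w × |α| × w` table of membership bits. -/
def encodeTransitions {α : Type*} [Fintype α] [LinearOrder α] {w : ℕ}
    (T : Finset (Fin w × α × Fin w)) : Data :=
  .ofList ((List.finRange w).map fun p =>
    .ofList ((letters α).map fun a =>
      .ofList ((List.finRange w).map fun q => .ofBool (decide ((p, a, q) ∈ T)))))

/-- A layer, as the list of its seven components. -/
def encodeLayer {α : Type*} [Fintype α] [LinearOrder α] {w : ℕ} (L : Layer α w) : Data :=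
  .ofList [encodeStates L.left, encodeStates L.right, encodeTransitions L.trans,
    encodeStates L.init, encodeStates L.fin, .ofBool L.initFlag, .ofBool L.finFlag]

/-- A string of layers, in particular an ordered decision diagram. -/
def encodeLayers {α : Type*} [Fintype α] [LinearOrder α] {w : ℕ} (D : List (Layer α w)) : Data :=
  .ofList (D.map encodeLayer)

/-- The input of the algorithms: the size of the alphabet, the bound `w`, a diagram `D`, and a
list `l` of layers. -/
def encodeInput {α : Type*} [Fintype α] [LinearOrder α] {w : ℕ} (D l : List (Layer α w)) : Data :=
  .ofList [.ofNat (Fintype.card α), .ofNat w, encodeLayers D, encodeLayers l]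

/-- The list `l` presents the set of layers `S`: it lists the elements of `S`, in any order,
without repetition. -/
def Presents {α : Type*} {w : ℕ} (l : List (Layer α w)) (S : Set (Layer α w)) : Prop :=
  l.Nodup ∧ ∀ L, L ∈ l ↔ L ∈ S

end ODD

/-!
A diagram with layers in `S` and the language of `D` is built from its last layer to its first.
Let `c` be a string of layers of `S` that may stand in the place of a suffix `D` of the given
diagram. The layers in front of `c` only depend on its *key*: its left frontier, its initial states
and the set of pairs `(A, B)` of sets of states such that `D` accepts from `A` what `c` accepts from
`B`. It is therefore enough to keep one lightest `c` for each key. A priori there are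
`2 ^ (4 ^ w)` sets of pairs, but having the same right language is an equivalence relation, so the
pairs are determined by choosing for every `B` one equivalent `A`, if there is any; this leaves
`2 ^ O(w * 2 ^ w)` keys. Weights are kept in unary, which costs `O(k)` steps for each of the `k`
layers.
-/

namespace ODD

open scoped Classical

noncomputable section

/-! ### One lightest element for each key -/

section Lightest

variable {β γ : Type*} (κ : β → γ) (μ : β → ℕ)

/-- Inserts `b` into a list without two elements of the same key `κ`, where it competes with the
element of its own key for the smaller weight `μ`. -/
def insertLightest (b : β) : List β → List β
  | [] => [b]
  | d :: ds => if κ b = κ d then (if μ b ≤ μ d then b else d) :: ds else d :: insertLightest b ds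

/-- One element of the least weight `μ` for each key `κ` that occurs in a list. -/
def lightestPerKey (bs : List β) : List β := bs.foldr (insertLightest κ μ) []

variable {κ μ} {b x : β} {bs ds : List β}

theorem eq_or_mem_of_mem_insertLightest (h : x ∈ insertLightest κ μ b ds) : x = b ∨ x ∈ ds := by
  induction ds with
  | nil => simpa [insertLightest] using h
  | cons d ds ih =>
    simp only [insertLightest] at h
    split_ifs at h <;> simp only [List.mem_cons] at h ⊢ <;> tauto

theorem map_insertLightest :
    (insertLightest κ μ b ds).map κ =
      if κ b ∈ ds.map κ then ds.map κ else ds.map κ ++ [κ b] := by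
  induction ds with
  | nil => simp [insertLightest]
  | cons d ds ih =>
    by_cases h : κ b = κ d
    · by_cases h' : μ b ≤ μ d <;> simp [insertLightest, h, h']
    · simp only [insertLightest, h, if_false, List.map_cons, ih, List.mem_cons, false_or]
      split_ifs <;> simp

theorem nodup_map_insertLightest (h : (ds.map κ).Nodup) :
    ((insertLightest κ μ b ds).map κ).Nodup := by
  rw [map_insertLightest]
  split_ifs with hb
  · exact h
  · simpa [List.nodup_append] using ⟨h, by simpa using hb⟩

theorem exists_le_insertLightest (hx : x = b ∨ x ∈ ds) :
    ∃ y ∈ insertLightest κ μ b ds, κ y = κ x ∧ μ y ≤ μ x := by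
  induction ds with
  | nil => exact ⟨b, by simp [insertLightest], by simp_all⟩
  | cons d ds ih =>
    simp only [insertLightest, List.mem_cons] at hx ⊢
    split_ifs with h h'
    · rcases hx with rfl | rfl | hx
      · exact ⟨x, by simp⟩
      · exact ⟨b, by simp, h, h'⟩
      · exact ⟨x, by simp [hx]⟩
    · rcases hx with rfl | rfl | hx
      · exact ⟨d, by simp, h.symm, (not_le.1 h').le⟩
      · exact ⟨x, by simp⟩
      · exact ⟨x, by simp [hx]⟩
    · rcases hx with rfl | rfl | hx
      · obtain ⟨y, hy, h⟩ := ih (.inl rfl)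
        exact ⟨y, by simp [hy], h⟩
      · exact ⟨x, by simp⟩
      · obtain ⟨y, hy, h⟩ := ih (.inr hx)
        exact ⟨y, by simp [hy], h⟩

theorem mem_of_mem_lightestPerKey (h : x ∈ lightestPerKey κ μ bs) : x ∈ bs := by
  induction bs with
  | nil => exact h
  | cons b bs ih =>
    exact List.mem_cons.2 ((eq_or_mem_of_mem_insertLightest h).imp_right ih)

theorem nodup_map_lightestPerKey : ((lightestPerKey κ μ bs).map κ).Nodup := by
  induction bs with
  | nil => simp [lightestPerKey]
  | cons b bs ih => exact nodup_map_insertLightest ih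

theorem exists_le_lightestPerKey (hx : x ∈ bs) :
    ∃ y ∈ lightestPerKey κ μ bs, κ y = κ x ∧ μ y ≤ μ x := by
  induction bs with
  | nil => simp at hx
  | cons b bs ih =>
    rcases List.mem_cons.1 hx with rfl | hx
    · exact exists_le_insertLightest (.inl rfl)
    · obtain ⟨y, hy, hκ, hμ⟩ := ih hx
      obtain ⟨z, hz, hκ', hμ'⟩ := exists_le_insertLightest (κ := κ) (μ := μ) (b := b) (.inr hy)
      exact ⟨z, hz, hκ'.trans hκ, hμ'.trans hμ⟩

theorem le_of_mem_lightestPerKey {y : β} (hy : y ∈ lightestPerKey κ μ bs) (hx : x ∈ bs)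
    (h : κ x = κ y) : μ y ≤ μ x := by
  obtain ⟨z, hz, hκ, hμ⟩ := exists_le_lightestPerKey (κ := κ) (μ := μ) hx
  rwa [List.inj_on_of_nodup_map nodup_map_lightestPerKey hz hy (hκ.trans h)] at hμ

end Lightest

variable {α : Type*} {w : ℕ}

/-! ### Right languages -/

section Language

/-- The states reached from the set `A` by transitions with the letter `a`. -/
def post (T : Finset (Fin w × α × Fin w)) (A : Finset (Fin w)) (a : α) : Finset (Fin w) :=
  Finset.univ.filter fun q => ∃ p ∈ A, (p, a, q) ∈ T

/-- The string of layers accepts a string from some state of the set `A`. A string may be accepted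
after any layer that has final states: in a diagram that is only the last one, and for arbitrary
strings of layers the recursion is then the same for the last layer and for the others. -/
def Accepts : List (Layer α w) → Finset (Fin w) → List α → Prop
  | [], _, _ => False
  | _ :: _, _, [] => False
  | L :: D, A, a :: s =>
    (s = [] ∧ (post L.trans A a ∩ L.fin).Nonempty) ∨ Accepts D (post L.trans A a) s

/-- The right language of a set of states. -/
def rlang (D : List (Layer α w)) (A : Finset (Fin w)) : Set (List α) := {s | Accepts D A s}

variable {D c : List (Layer α w)} {L L' : Layer α w} {A B : Finset (Fin w)} {a : α} {s : List α}

theorem mem_post {T : Finset (Fin w × α × Fin w)} {q : Fin w} :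
    q ∈ post T A a ↔ ∃ p ∈ A, (p, a, q) ∈ T := by
  simp [post]

theorem not_accepts_nil : ¬ Accepts D A [] := by
  cases D <;> simp [Accepts]

theorem rlang_cons_eq_iff : rlang (L :: D) A = rlang (L' :: c) B ↔
    ∀ a, ((post L.trans A a ∩ L.fin).Nonempty ↔ (post L'.trans B a ∩ L'.fin).Nonempty) ∧
      rlang D (post L.trans A a) = rlang c (post L'.trans B a) := by
  simp only [rlang, Set.ext_iff, Set.mem_ofPred_eq]
  constructor
  · refine fun h a => ⟨by simpa [Accepts, not_accepts_nil] using h [a], fun s => ?_⟩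
    cases s with
    | nil => simp [not_accepts_nil]
    | cons b s => simpa [Accepts] using h (a :: b :: s)
  · rintro h (_ | ⟨a, s⟩)
    · simp [Accepts]
    · simp [Accepts, (h a).1, (h a).2]

/-- `r` is a sequence of transitions that accepts `s` from a state of the set `A`. -/
structure IsAcceptingFrom (D : List (Layer α w)) (A : Finset (Fin w)) (s : List α)
    (r : List (Fin w × α × Fin w)) : Prop where
  trans : List.Forall₂ (fun e L => e ∈ L.trans) r D
  letters : r.map (fun e => e.2.1) = s
  linked : r.IsChain (fun e e' => e'.1 = e.2.2)
  initial : ∃ e ∈ r.head?, e.1 ∈ A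
  final : ∃ e ∈ r.getLast?, ∃ L ∈ D.getLast?, e.2.2 ∈ L.fin

theorem exists_isAcceptingFrom_singleton :
    (∃ r, IsAcceptingFrom [L] A (a :: s) r) ↔ s = [] ∧ (post L.trans A a ∩ L.fin).Nonempty := by
  constructor
  · rintro ⟨r, ht, hs, -, hi, hf⟩
    obtain ⟨e, r, he, hr, rfl⟩ := List.forall₂_cons_right_iff.1 ht
    obtain rfl := List.forall₂_nil_right_iff.1 hr
    obtain ⟨rfl, rfl⟩ := List.cons.inj hs
    simp only [List.head?_cons, List.getLast?_singleton, Option.mem_some_iff,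
      exists_eq_left'] at hi hf
    exact ⟨rfl, e.2.2, Finset.mem_inter.2 ⟨mem_post.2 ⟨e.1, hi, he⟩, hf⟩⟩
  · rintro ⟨rfl, q, hq⟩
    obtain ⟨hq, hf⟩ := Finset.mem_inter.1 hq
    obtain ⟨p, hp, he⟩ := mem_post.1 hq
    exact ⟨[(p, a, q)], ⟨by simpa, rfl, by simp, by simpa, by simpa⟩⟩

theorem exists_isAcceptingFrom_cons_cons :
    (∃ r, IsAcceptingFrom (L :: L' :: D) A (a :: s) r) ↔
      ∃ r, IsAcceptingFrom (L' :: D) (post L.trans A a) s r := by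
  constructor
  · rintro ⟨r, ht, hs, hl, hi, hf⟩
    obtain ⟨e, r, he, hr, rfl⟩ := List.forall₂_cons_right_iff.1 ht
    obtain ⟨e', r, -, -, rfl⟩ := List.forall₂_cons_right_iff.1 hr
    obtain ⟨rfl, rfl⟩ := List.cons.inj hs
    rw [List.isChain_cons_cons] at hl
    simp only [List.head?_cons, Option.mem_some_iff, exists_eq_left'] at hi
    exact ⟨e' :: r, hr, rfl, hl.2, ⟨e', rfl, mem_post.2 ⟨e.1, hi, hl.1 ▸ he⟩⟩,
      by simpa [List.getLast?_cons_cons] using hf⟩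
  · rintro ⟨r, hr, hs, hl, hi, hf⟩
    obtain ⟨e, r, -, -, rfl⟩ := List.forall₂_cons_right_iff.1 hr
    simp only [List.head?_cons, Option.mem_some_iff, exists_eq_left', mem_post] at hi
    obtain ⟨p, hp, he⟩ := hi
    exact ⟨(p, a, e.1) :: e :: r, .cons he hr, by simpa using hs, by simpa using hl,
      by simpa, by simpa [List.getLast?_cons_cons] using hf⟩

theorem accepts_iff_exists_isAcceptingFrom (hD : D.IsChain fun L _ => L.fin = ∅) :
    Accepts D A s ↔ ∃ r, IsAcceptingFrom D A s r := by
  induction D generalizing A s with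
  | nil => exact iff_of_false id fun ⟨_, h⟩ => by simpa using h.final
  | cons L D ih =>
    cases s with
    | nil =>
      refine iff_of_false id ?_
      rintro ⟨_, ⟨⟨⟩, hs, -⟩⟩
      simp at hs
    | cons a s =>
      cases D with
      | nil => simp [Accepts, exists_isAcceptingFrom_singleton]
      | cons L' D =>
        rw [List.isChain_cons_cons] at hD
        rw [exists_isAcceptingFrom_cons_cons, ← ih hD.2]
        simp [Accepts, hD.1]

/-- The initial states of a string of layers. -/
def firstInit : List (Layer α w) → Finset (Fin w)
  | [] => ∅
  | L :: _ => L.init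

theorem isAccepting_iff {r : List (Fin w × α × Fin w)} :
    IsAccepting D s r ↔ IsAcceptingFrom D (firstInit D) s r := by
  constructor
  · rintro ⟨ht, hs, hl, ⟨e, he, L, hL, hi⟩, hf⟩
    cases D with
    | nil => simp at hL
    | cons M D => exact ⟨ht, hs, hl, ⟨e, he, by simp_all [firstInit]⟩, hf⟩
  · rintro ⟨ht, hs, hl, ⟨e, he, hi⟩, hf⟩
    cases D with
    | nil => simp [firstInit] at hi
    | cons M D => exact ⟨ht, hs, hl, ⟨e, he, M, rfl, hi⟩, hf⟩

theorem IsODD.isChain_fin_eq_empty (hD : IsODD D) : D.IsChain fun L _ => L.fin = ∅ := by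
  refine List.isChain_iff_getElem.2 fun i hi => (D[i]).fin_flag (Bool.eq_false_iff.2 ?_)
  rw [ne_eq, hD.finFlag]
  omega

theorem IsODD.lang_eq (hD : IsODD D) : lang D = (D.length, rlang D (firstInit D)) := by
  refine Prod.ext rfl (Set.ext fun s => ?_)
  simp only [lang, rlang, Set.mem_ofPred_eq, isAccepting_iff,
    accepts_iff_exists_isAcceptingFrom hD.isChain_fin_eq_empty]

end Language

/-! ### Strings of layers in the place of a diagram -/

section Matching

/-- The left frontier of a string of layers. -/
def leftFrontier : List (Layer α w) → Finset (Fin w)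
  | [] => ∅
  | L :: _ => L.left

/-- The layer `L'` can stand in the place of `L`, in front of a string of layers with the left
frontier `A`. The frontier does not matter for a last layer. -/
def Fits (L L' : Layer α w) (A : Finset (Fin w)) : Prop :=
  L'.initFlag = L.initFlag ∧ L'.finFlag = L.finFlag ∧ (L.finFlag = true ∨ L'.right = A)

/-- `Matches S D c`: the string `c` of layers from `S` can stand in the place of `D`. -/
inductive Matches (S : Set (Layer α w)) : List (Layer α w) → List (Layer α w) → Prop
  | nil : Matches S [] []
  | cons {L L' : Layer α w} {D c : List (Layer α w)} (mem : L' ∈ S)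
      (fits : Fits L L' (leftFrontier c)) (tail : Matches S D c) : Matches S (L :: D) (L' :: c)

variable {S : Set (Layer α w)} {D c : List (Layer α w)}

theorem matches_iff
    (hD : ∀ (i : ℕ) (h : i < D.length), D[i].finFlag = true ↔ i + 1 = D.length) :
    Matches S D c ↔ (∀ L ∈ c, L ∈ S) ∧ c.IsChain (fun L L' => L'.left = L.right) ∧
      List.Forall₂ (fun L L' => L'.initFlag = L.initFlag ∧ L'.finFlag = L.finFlag) D c := by
  induction D generalizing c with
  | nil =>
    refine ⟨?_, ?_⟩
    · rintro ⟨⟩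
      simp
    · rintro ⟨-, -, ⟨⟩⟩
      exact .nil
  | cons L D ih =>
    have hlast : L.finFlag = true ↔ D = [] :=
      (hD 0 (Nat.succ_pos _)).trans (by cases D <;> simp)
    have ih := @ih c.tail fun i hi =>
      (hD (i + 1) (Nat.succ_lt_succ hi)).trans Nat.add_right_cancel_iff
    constructor
    · rintro (_ | @⟨_, L', _, c, hS, hfit, hc⟩)
      obtain ⟨hS', hchain, hflags⟩ := ih.1 hc
      refine ⟨by simp_all, ?_, .cons ⟨hfit.1, hfit.2.1⟩ hflags⟩
      cases hc with
      | nil => simp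
      | cons _ _ _ =>
        exact List.isChain_cons_cons.2 ⟨(hfit.2.2.resolve_left (by simp [hlast])).symm, hchain⟩
    · rintro ⟨hS, hchain, h⟩
      obtain ⟨L', c, hflags, hf, rfl⟩ := List.forall₂_cons_left_iff.1 h
      refine .cons (hS L' (by simp)) ⟨hflags.1, hflags.2, ?_⟩
        (ih.2 ⟨fun M hM => hS M (by simp_all), hchain.tail, hf⟩)
      cases hf with
      | nil => exact .inl (hlast.2 rfl)
      | cons _ _ => exact .inr (List.isChain_cons_cons.1 hchain).1.symm

theorem Matches.length_eq (h : Matches S D c) : c.length = D.length := by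
  induction h with
  | nil => rfl
  | cons _ _ _ ih => simp [ih]

theorem matches_iff_mem_oddsOfLength {k : ℕ} (hD : D ∈ oddsOfLength Set.univ k) :
    Matches S D c ↔ c ∈ oddsOfLength S k := by
  obtain ⟨hO, rfl, -⟩ := hD
  rw [matches_iff hO.finFlag, List.forall₂_iff_get]
  simp only [List.get_eq_getElem]
  constructor
  · rintro ⟨hS, hchain, hlen, hflags⟩
    refine ⟨⟨?_, hchain, fun i hi => ?_, fun i hi => ?_⟩, hlen.symm, hS⟩
    · rintro rfl
      exact hO.ne_nil (List.length_eq_zero_iff.1 hlen)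
    · rw [(hflags i (hlen ▸ hi) hi).1, hO.initFlag]
    · rw [(hflags i (hlen ▸ hi) hi).2, hO.finFlag, hlen]
  · rintro ⟨hc, hlen, hS⟩
    refine ⟨hS, hc.frontier, hlen.symm, fun i hi hi' => ⟨Bool.eq_iff_iff.2 ?_,
      Bool.eq_iff_iff.2 ?_⟩⟩
    · rw [hc.initFlag, hO.initFlag]
    · rw [hc.finFlag, hO.finFlag, hlen]

end Matching

/-! ### Keys -/

section Keys

/-- What a string of layers in the place of a suffix of the given diagram has to tell the layers
in front of it. -/
@[ext]
structure Key (w : ℕ) where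
  /-- the left frontier -/
  frontier : Finset (Fin w)
  /-- the initial states -/
  init : Finset (Fin w)
  /-- the pairs `(A, B)` such that the suffix has from `A` the right language of the string from
  `B` -/
  equiv : Set (Finset (Fin w) × Finset (Fin w))

/-- The key of `c` in the place of `D`. -/
@[simps]
def key (D c : List (Layer α w)) : Key w where
  frontier := leftFrontier c
  init := firstInit c
  equiv := {q | rlang D q.1 = rlang c q.2}

/-- After the layers `L` and `L'`, nothing tells the sets of states of `X` apart, where `E` is the
set of the pairs that the following layers do not tell apart. -/
def Agree (L L' : Layer α w) (E : Set (Finset (Fin w) × Finset (Fin w)))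
    (X : Finset (Fin w) × Finset (Fin w)) : Prop :=
  ((X.1 ∩ L.fin).Nonempty ↔ (X.2 ∩ L'.fin).Nonempty) ∧ X ∈ E

/-- The key after putting `L'` in the place of `L` in front of a string with the key `K`. -/
@[simps]
def Key.next (L L' : Layer α w) (K : Key w) : Key w where
  frontier := L'.left
  init := L'.init
  equiv := {q | ∀ a, Agree L L' K.equiv (post L.trans q.1 a, post L'.trans q.2 a)}

theorem key_cons (L L' : Layer α w) (D c : List (Layer α w)) :
    key (L :: D) (L' :: c) = (key D c).next L L' := by
  ext : 1
  · rfl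
  · rfl
  · exact Set.ext fun q => rlang_cons_eq_iff

/-- A bound on the number of keys of the strings of layers in the place of a diagram: the equivalent
pairs are determined by a partial function from sets to sets. -/
def keyCount (w : ℕ) : ℕ := 2 ^ w * (2 ^ w * (2 ^ w + 1) ^ 2 ^ w)

theorem length_le_keyCount {D : List (Layer α w)} {cs : List (List (Layer α w))}
    (h : (cs.map (key D)).Nodup) : cs.length ≤ keyCount w := by
  let ofChoice (x : Finset (Fin w) × Finset (Fin w) × (Finset (Fin w) → Option (Finset (Fin w)))) :
      Key w := ⟨x.1, x.2.1, {q | ∃ A ∈ x.2.2 q.2, rlang D q.1 = rlang D A}⟩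
  have key_mem (c : List (Layer α w)) : key D c ∈ Finset.univ.image ofChoice := by
    refine Finset.mem_image.2 ⟨⟨leftFrontier c, firstInit c, fun B =>
      if h : ∃ A, rlang D A = rlang c B then some h.choose else none⟩, Finset.mem_univ _, ?_⟩
    refine Key.ext rfl rfl (Set.ext fun q => ?_)
    by_cases h : ∃ A, rlang D A = rlang c q.2
    · simp [ofChoice, h, h.choose_spec]
    · simpa [ofChoice, h] using fun e => h ⟨_, e⟩
  calc cs.length = (cs.map (key D)).toFinset.card := by
        rw [List.toFinset_card_of_nodup h, List.length_map]
    _ ≤ (Finset.univ.image ofChoice).card := Finset.card_le_card fun K hK => by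
        obtain ⟨c, -, rfl⟩ := List.mem_map.1 (List.mem_toFinset.1 hK)
        exact key_mem c
    _ ≤ keyCount w := Finset.card_image_le.trans_eq (by simp [keyCount, Fintype.card_option])

end Keys

/-! ### The lightest strings of layers -/

section Solve

/-- The weight of a string of layers, accumulated from its last layer to its first. -/
def weight (stp : Layer α w → ℕ → ℕ) (c : List (Layer α w)) : ℕ := c.foldr stp 0

/-- The strings `L' :: c` with `(L', c)` from `xs` and a layer `L'` that fits in the place of
`L`. -/
def extensions (L : Layer α w) (xs : List (Layer α w × List (Layer α w))) :
    List (List (Layer α w)) :=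
  (xs.filter fun x => Fits L x.1 (leftFrontier x.2)).map fun x => x.1 :: x.2

/-- Lightest strings of layers from `l` that match `D`, for all keys. -/
def solve (stp : Layer α w → ℕ → ℕ) (l : List (Layer α w)) :
    List (Layer α w) → List (List (Layer α w))
  | [] => [[]]
  | L :: D => lightestPerKey (key (L :: D)) (weight stp) (extensions L (l.product (solve stp l D)))

/-- The string of layers `c`, with its own initial states, accepts the same strings as `D`. -/
def SameLang (D c : List (Layer α w)) : Prop := (firstInit D, firstInit c) ∈ (key D c).equiv

/-- A lightest string of layers from `l` that matches `D` and has the same language, in a list of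
length one, or the empty list if there is none. -/
def solution (stp : Layer α w → ℕ → ℕ) (l D : List (Layer α w)) : List (List (Layer α w)) :=
  lightestPerKey (fun _ => ()) (weight stp) ((solve stp l D).filter fun c => SameLang D c)

variable {stp : Layer α w → ℕ → ℕ} {l D c : List (Layer α w)} {S : Set (Layer α w)}

theorem mem_extensions {L : Layer α w} {cs : List (List (Layer α w))} :
    c ∈ extensions L (l.product cs) ↔
      ∃ L' ∈ l, ∃ d ∈ cs, Fits L L' (leftFrontier d) ∧ L' :: d = c := by
  simp only [extensions, List.mem_map, List.mem_filter, Prod.exists, List.pair_mem_product,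
    decide_eq_true_eq]
  tauto

theorem nodup_map_key_solve : ((solve stp l D).map (key D)).Nodup := by
  cases D with
  | nil => simp [solve]
  | cons L D => exact nodup_map_lightestPerKey

theorem matches_of_mem_solve (hl : ∀ L, L ∈ l ↔ L ∈ S) (hc : c ∈ solve stp l D) :
    Matches S D c := by
  induction D generalizing c with
  | nil => rw [List.mem_singleton.1 hc]; exact .nil
  | cons L D ih =>
    obtain ⟨L', hL', d, hd, hf, rfl⟩ := mem_extensions.1 (mem_of_mem_lightestPerKey hc)
    exact .cons ((hl L').1 hL') hf (ih hd)

theorem length_of_mem_solve (hc : c ∈ solve stp l D) : c.length = D.length :=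
  (matches_of_mem_solve (S := {L | L ∈ l}) (fun _ => Iff.rfl) hc).length_eq

theorem exists_le_solve (hstp : ∀ L, Monotone (stp L)) (hl : ∀ L, L ∈ l ↔ L ∈ S)
    (hc : Matches S D c) :
    ∃ d ∈ solve stp l D, key D d = key D c ∧ weight stp d ≤ weight stp c := by
  induction hc with
  | nil => exact ⟨[], by simp [solve]⟩
  | @cons L L' D c hS hf _ ih =>
    obtain ⟨d, hd, hkey, hle⟩ := ih
    rw [← show leftFrontier d = leftFrontier c from congrArg Key.frontier hkey] at hf
    obtain ⟨e, he, hkey', hle'⟩ := exists_le_lightestPerKey (κ := key (L :: D)) (μ := weight stp)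
      (mem_extensions.2 ⟨L', (hl L').2 hS, d, hd, hf, rfl⟩)
    refine ⟨e, he, ?_, hle'.trans (hstp L' hle)⟩
    rw [hkey', key_cons, hkey, ← key_cons]

variable {k : ℕ}

theorem sameLang_iff (hD : D ∈ oddsOfLength Set.univ k) (hc : c ∈ oddsOfLength S k) :
    SameLang D c ↔ lang c = lang D := by
  rw [hD.1.lang_eq, hc.1.lang_eq, hD.2.1, hc.2.1, Prod.mk_right_inj, eq_comm]
  rfl

theorem sameLang_congr {d : List (Layer α w)} (h : key D c = key D d) :
    SameLang D c ↔ SameLang D d := by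
  unfold SameLang
  rw [h, show firstInit c = firstInit d from congrArg Key.init h]

theorem exists_mem_solve_of_lang_eq (hstp : ∀ L, Monotone (stp L)) (hl : ∀ L, L ∈ l ↔ L ∈ S)
    (hD : D ∈ oddsOfLength Set.univ k) (hc : c ∈ oddsOfLength S k) (h : lang c = lang D) :
    ∃ d ∈ (solve stp l D).filter fun c => SameLang D c, weight stp d ≤ weight stp c := by
  obtain ⟨d, hd, hkey, hle⟩ := exists_le_solve hstp hl ((matches_iff_mem_oddsOfLength hD).2 hc)
  have hsame := (sameLang_congr hkey).2 ((sameLang_iff hD hc).2 h)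
  exact ⟨d, List.mem_filter.2 ⟨hd, decide_eq_true hsame⟩, hle⟩

theorem isMinimizer_of_mem_solution (hk : 0 < k) (hstp : ∀ L, Monotone (stp L))
    (hl : ∀ L, L ∈ l ↔ L ∈ S) (hD : D ∈ oddsOfLength Set.univ k) (hc : c ∈ solution stp l D) :
    c ∈ oddsOfLength S k ∧ IsMinimizer (weight stp) S D c := by
  obtain ⟨hsolve, hsame⟩ := List.mem_filter.1 (mem_of_mem_lightestPerKey hc)
  have hcS := (matches_iff_mem_oddsOfLength hD).1 (matches_of_mem_solve hl hsolve)
  refine ⟨hcS, ⟨k, hk, hcS⟩, (sameLang_iff hD hcS).1 (of_decide_eq_true hsame), ?_⟩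
  rintro c' ⟨k', -, hc'⟩ hlang
  obtain rfl : k' = k := by
    rw [← hc'.2.1, ← hD.2.1]
    exact congrArg Prod.fst hlang
  obtain ⟨d, hd, hle⟩ := exists_mem_solve_of_lang_eq hstp hl hD hc' hlang
  exact (le_of_mem_lightestPerKey hc hd rfl).trans hle

theorem solution_ne_nil_iff (hk : 0 < k) (hstp : ∀ L, Monotone (stp L))
    (hl : ∀ L, L ∈ l ↔ L ∈ S) (hD : D ∈ oddsOfLength Set.univ k) :
    solution stp l D ≠ [] ↔ ∃ D' ∈ oddsOfLength S k, lang D' = lang D := by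
  constructor
  · intro h
    obtain ⟨c, hc⟩ := List.exists_mem_of_ne_nil _ h
    obtain ⟨hcS, hmin⟩ := isMinimizer_of_mem_solution hk hstp hl hD hc
    exact ⟨c, hcS, hmin.2.1⟩
  · rintro ⟨c, hc, hlang⟩
    obtain ⟨d, hd, -⟩ := exists_mem_solve_of_lang_eq hstp hl hD hc hlang
    obtain ⟨e, he, -⟩ := exists_le_lightestPerKey (κ := fun _ => ()) (μ := weight stp) hd
    exact List.ne_nil_of_mem he

end Solve

/-! ### Bounds on the running time of programs -/

section Within

/-- In the program `P`, with the bindings `env`, the expression `e` evaluates to `v` in at most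
`T` steps. -/
def Within (P : Program) (env : List Data) (e : Expr) (v : Data) (T : ℕ) : Prop :=
  ∃ t ≤ T, Eval P env e v t

/-- Function number `f` of the program `P` maps `x` to `v` in at most `T` steps. -/
def Calls (P : Program) (f : ℕ) (x v : Data) (T : ℕ) : Prop :=
  Within P [x] (P.getD f .nil) v T

/-- The value of an expression made of accesses to components of variables and of constructors,
`none` for other expressions. -/
def Expr.access (env : List Data) : Expr → Option Data
  | .var i => some (env.getD i .nil)
  | .nil => some .nil
  | .cons a b => (a.access env).bind fun u => (b.access env).map (.cons u)
  | .fst a => (a.access env).map .fst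
  | .snd a => (a.access env).map .snd
  | .ite _ _ _ | .letIn _ _ | .call _ _ => none

/-- The number of nodes of an expression. -/
def Expr.size : Expr → ℕ
  | .var _ | .nil => 1
  | .cons a b | .letIn a b => a.size + b.size + 1
  | .fst a | .snd a | .call _ a => a.size + 1
  | .ite c a b => c.size + a.size + b.size + 1

variable {P : Program} {env : List Data} {e a b c : Expr} {u v v' : Data} {s t t' T f : ℕ}

theorem eval_of_access_eq (h : e.access env = some v) : Eval P env e v e.size := by
  induction e generalizing v with
  | var i => obtain rfl := Option.some.inj h; exact .var env i
  | nil => obtain rfl := Option.some.inj h; exact .nil env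
  | cons a b iha ihb =>
    obtain ⟨x, hx, h⟩ := Option.bind_eq_some_iff.1 h
    obtain ⟨y, hy, rfl⟩ := Option.map_eq_some_iff.1 h
    exact .cons (iha hx) (ihb hy)
  | fst a ih => obtain ⟨x, hx, rfl⟩ := Option.map_eq_some_iff.1 h; exact .fst (ih hx)
  | snd a ih => obtain ⟨x, hx, rfl⟩ := Option.map_eq_some_iff.1 h; exact .snd (ih hx)
  | ite | letIn | call => simp [Expr.access] at h

namespace Within

theorem mono (h : Within P env e v t) (ht : t ≤ T) : Within P env e v T := by
  obtain ⟨r, hr, h⟩ := h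
  exact ⟨r, hr.trans ht, h⟩

theorem conv (h : Within P env e v t) (hv : v = v') (ht : t ≤ T) : Within P env e v' T :=
  hv ▸ h.mono ht

theorem access (h : e.access env = some v) (hs : e.size ≤ 40 := by decide) :
    Within P env e v 40 :=
  ⟨_, hs, eval_of_access_eq h⟩

theorem cons (ha : Within P env a u s) (hb : Within P env b v t) :
    Within P env (.cons a b) (.cons u v) (s + t + 1) := by
  obtain ⟨r, hr, ha⟩ := ha
  obtain ⟨r', hr', hb⟩ := hb
  exact ⟨r + r' + 1, by omega, .cons ha hb⟩

theorem fst (h : Within P env a u s) : Within P env (.fst a) u.fst (s + 1) := by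
  obtain ⟨r, hr, h⟩ := h
  exact ⟨r + 1, by omega, .fst h⟩

theorem snd (h : Within P env a u s) : Within P env (.snd a) u.snd (s + 1) := by
  obtain ⟨r, hr, h⟩ := h
  exact ⟨r + 1, by omega, .snd h⟩

theorem iteNil (hc : Within P env c .nil s) (h : Within P env b v t) :
    Within P env (.ite c a b) v (s + t + 1) := by
  obtain ⟨r, hr, hc⟩ := hc
  obtain ⟨r', hr', h⟩ := h
  exact ⟨r + r' + 1, by omega, .iteNil hc h⟩

theorem iteCons {x y : Data} (hc : Within P env c (.cons x y) s) (h : Within P env a v t) :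
    Within P env (.ite c a b) v (s + t + 1) := by
  obtain ⟨r, hr, hc⟩ := hc
  obtain ⟨r', hr', h⟩ := h
  exact ⟨r + r' + 1, by omega, .iteCons hc h⟩

theorem ite {q : Bool} (hc : Within P env c (.ofBool q) s)
    (ha : q = true → Within P env a v t) (hb : q = false → Within P env b v' t') :
    Within P env (.ite c a b) (if q then v else v') (s + max t t' + 1) := by
  cases q
  · exact (iteNil hc (hb rfl)).mono (by omega)
  · exact (iteCons hc (ha rfl)).mono (by omega)

theorem letIn (ha : Within P env a u s) (hb : Within P (u :: env) b v t) :
    Within P env (.letIn a b) v (s + t + 1) := by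
  obtain ⟨r, hr, ha⟩ := ha
  obtain ⟨r', hr', hb⟩ := hb
  exact ⟨r + r' + 1, by omega, .letIn ha hb⟩

theorem call (hf : Calls P f u v t) (ha : Within P env a u s) :
    Within P env (.call f a) v (s + t + 1) := by
  obtain ⟨r, hr, ha⟩ := ha
  obtain ⟨r', hr', hf⟩ := hf
  exact ⟨r + r' + 1, by omega, .call ha hf⟩

end Within

theorem Calls.mono {x : Data} (h : Calls P f x v t) (ht : t ≤ T) : Calls P f x v T :=
  Within.mono h ht

theorem Calls.intro {x : Data} (hP : P.getD f .nil = e) (h : Within P [x] e v t) :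
    Calls P f x v t := by
  rwa [Calls, hP]

/-! ### Right folds -/

namespace Prog

/-- The argument of the current function. -/
abbrev arg : Expr := .var 0

/-- The truth value `true`. -/
abbrev one : Expr := .cons .nil .nil

/-- The body of function number `f` that maps `(p, l)` to the right fold over the list `l`: it
evaluates `base` if `l` is empty, and otherwise `step` with the value `acc` for the tail of `l` as
its innermost binding. -/
def foldBody (f : ℕ) (base step : Expr) : Expr :=
  .ite (.snd arg) (.letIn (.call f (.cons (.fst arg) (.snd (.snd arg)))) step) base

/-- The value of a fold for the tail of the list, in its step. -/
abbrev acc : Expr := .var 0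

/-- The parameter `p` of a fold, in its step. -/
abbrev par : Expr := .fst (.var 1)

/-- The head of the list, in the step of a fold. -/
abbrev head : Expr := .fst (.snd (.var 1))

/-- The tail of the list, in the step of a fold. -/
abbrev tail : Expr := .snd (.snd (.var 1))

end Prog

open Prog in
theorem Calls.fold {ι : Type*} {base step : Expr} (hP : P.getD f .nil = foldBody f base step)
    {p : Data} (enc : ι → Data) (F : List ι → Data) {C : ℕ} (l : List ι)
    (hbase : Within P [.cons p .nil] base (F []) C)
    (hstep : ∀ x xs, x :: xs <:+ l →
      Within P [F xs, .cons p (.ofList ((x :: xs).map enc))] step (F (x :: xs)) C) :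
    Calls P f (.cons p (.ofList (l.map enc))) (F l) ((C + 100) * (l.length + 1)) := by
  unfold Calls
  rw [hP]
  induction l with
  | nil => exact (Within.iteNil (.access rfl) hbase).mono (by simp; omega)
  | cons x xs ih =>
    have ih := ih fun y ys hy => hstep y ys (hy.trans (List.suffix_cons x xs))
    rw [← hP] at ih
    refine (Within.iteCons (.access (v := .ofList ((x :: xs).map enc)) rfl)
      (.letIn (.call ih (.access rfl)) (hstep x xs (List.suffix_refl _)))).mono ?_
    rw [List.length_cons]
    linarith [Nat.zero_le C]

open Prog in
theorem Calls.foldNat {base step : Expr} (hP : P.getD f .nil = foldBody f base step)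
    {p : Data} (F : ℕ → Data) {C : ℕ} (n : ℕ) (hbase : Within P [.cons p .nil] base (F 0) C)
    (hstep : ∀ m < n, Within P [F m, .cons p (.ofNat (m + 1))] step (F (m + 1)) C) :
    Calls P f (.cons p (.ofNat n)) (F n) ((C + 100) * (n + 1)) := by
  have h := Calls.fold hP (fun _ : Unit => .nil) (fun l => F l.length) (List.replicate n ()) hbase
    fun x xs hx => by
      have hlen : xs.length < n := by simpa using hx.length_le
      simpa [Data.ofNat, List.replicate_succ] using hstep _ hlen
  simpa [Data.ofNat] using h

end Within

/-! ### The program -/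

namespace Prog

-- The positions of the functions in `prog`, below the main function at position 0.

abbrev fEq : ℕ := 1
abbrev fZip : ℕ := 2
abbrev fOr : ℕ := 3
abbrev fOrRows : ℕ := 4
abbrev fPost : ℕ := 5
abbrev fMeets : ℕ := 6
abbrev fMem : ℕ := 7
abbrev fCheck : ℕ := 8
abbrev fFilter : ℕ := 9
abbrev fSub : ℕ := 10
abbrev fInsert : ℕ := 11
abbrev fPairWith : ℕ := 12
abbrev fPairs : ℕ := 13
abbrev fExtend : ℕ := 14
abbrev fSolve : ℕ := 15
abbrev fChoose : ℕ := 16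
abbrev fSubsets : ℕ := 17
abbrev fReplicate : ℕ := 18
abbrev fWeight : ℕ := 19
abbrev fCount : ℕ := 20
abbrev fCountRows : ℕ := 21
abbrev fCountTable : ℕ := 22
abbrev fMax : ℕ := 23

/-- Equality of trees; the argument is `(x, y)`. -/
def eqBody : Expr :=
  .ite (.fst arg)
    (.ite (.snd arg)
      (.ite (.call fEq (.cons (.fst (.fst arg)) (.fst (.snd arg))))
        (.call fEq (.cons (.snd (.fst arg)) (.snd (.snd arg)))) .nil)
      .nil)
    (.ite (.snd arg) .nil one)

/-- The list of the pairs of corresponding elements of two lists of the same length. -/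
def zipBody : Expr :=
  .ite (.fst arg)
    (.cons (.cons (.fst (.fst arg)) (.fst (.snd arg)))
      (.call fZip (.cons (.snd (.fst arg)) (.snd (.snd arg)))))
    .nil

/-- The argument for a fold over the zip of two lists that has no parameter. -/
abbrev zipped (e : Expr) : Expr := .cons .nil (.call fZip e)

/-- Bitwise disjunction; the list holds pairs of bits. -/
def orBody : Expr :=
  foldBody fOr .nil (.cons (.ite (.fst head) one (.snd head)) acc)

/-- Bitwise disjunction of tables; the list holds pairs of rows. -/
def orRowsBody : Expr :=
  foldBody fOrRows .nil (.cons (.call fOr (zipped head)) acc)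

/-- The sets of successors of a set of states, for all letters; the parameter is the result for
the empty set, and the list holds for every state its membership bit and its table of
transitions. -/
def postBody : Expr :=
  foldBody fPost (.fst arg)
    (.ite (.fst head) (.call fOrRows (zipped (.cons (.snd head) acc))) acc)

/-- The sets of successors of the set of states given by `a`, for the transitions given by `t`; the
successors of the empty set are given by `z`. -/
def successors (z a t : Expr) : Expr := .call fPost (.cons z (.call fZip (.cons a t)))

/-- Whether two sets of states meet; the list holds pairs of membership bits. -/
def meetsBody : Expr :=
  foldBody fMeets .nil (.ite (.fst head) (.ite (.snd head) one acc) acc)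

/-- Whether the sets of states given by `a` and `b` meet. -/
def meets (a b : Expr) : Expr := .call fMeets (zipped (.cons a b))

/-- Whether the parameter belongs to the list. -/
def memBody : Expr :=
  foldBody fMem .nil (.ite (.call fEq (.cons par head)) one acc)

/-- Whether the pair of sets of states given by `q` agrees; `χ` is `((F, F'), E)` with the final
states `F`, `F'` of the two layers and the list `E` of the equivalent pairs behind them. -/
def agrees (q χ : Expr) : Expr :=
  .ite
    (.call fEq (.cons (meets (.fst q) (.fst (.fst χ))) (meets (.snd q) (.snd (.fst χ)))))
    (.call fMem (.cons q (.snd χ)))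
    .nil

/-- Whether all pairs of sets of states in the list agree. -/
def checkBody : Expr :=
  foldBody fCheck one (.ite (agrees head par) acc .nil)

/-- The equivalent pairs of sets of states in the list; the parameter is `(z, (T, T'), χ)` with the
successors `z` of the empty set, the transitions `T`, `T'` of the two layers and the parameter `χ`
of the function that checks successors. -/
def filterBody : Expr :=
  foldBody fFilter .nil
    (.ite
      (.call fCheck (.cons (.snd (.snd par)) (.call fZip (.cons
        (successors (.fst par) (.fst head) (.fst (.fst (.snd par))))
        (successors (.fst par) (.snd head) (.snd (.fst (.snd par))))))))
      (.cons head acc)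
      acc)

/-- Truncated subtraction of the list from the parameter, both of them unary numbers. -/
def subBody : Expr :=
  foldBody fSub (.fst arg) (.snd acc)

/-- The lighter one of the entries given by `b` and `d`. -/
def lighter (b d : Expr) : Expr :=
  .ite (.call fSub (.cons (.fst (.snd b)) (.fst (.snd d)))) d b

/-- Insertion of an entry `(key, weight, value)` into the list, where it competes with the entry of
its own key for the smaller weight. -/
def insertBody : Expr :=
  foldBody fInsert (.cons (.fst arg) .nil)
    (.ite (.call fEq (.cons (.fst par) (.fst head)))
      (.cons (lighter par head) tail)
      (.cons head acc))

/-- The pairs of `x` with the elements of the list, in front of `l`; the parameter is `(x, l)`. -/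
def pairWithBody : Expr :=
  foldBody fPairWith (.snd (.fst arg)) (.cons (.cons (.fst par) head) acc)

/-- All pairs of an element of the list and an element of the parameter. -/
def pairsBody : Expr :=
  foldBody fPairs .nil (.call fPairWith (.cons (.cons head acc) par))

/-- Component number `i` of a layer. -/
def comp (e : Expr) : ℕ → Expr
  | 0 => .fst e
  | i + 1 => comp (.snd e) i

/-- Whether the layer `L'` fits in the place of `L` in front of a string with the left frontier
`A`. -/
def fits (L L' A : Expr) : Expr :=
  .ite (.call fEq (.cons (comp L' 5) (comp L 5)))
    (.ite (.call fEq (.cons (comp L' 6) (comp L 6)))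
      (.ite (comp L 6) one (.call fEq (.cons (comp L' 1) A)))
      .nil)
    .nil

/-- The entry `(key, weight, string)` for putting `L'` in the place of `L` in front of a string with
the entry `c`; `globals` is `(z, pairs)` with the successors `z` of the empty set and the list of
all pairs of sets. -/
def nextEntry (globals L L' c : Expr) : Expr :=
  .cons
    (.cons (comp L' 0) (.cons (comp L' 3)
      (.call fFilter (.cons
        (.cons (.fst globals) (.cons (.cons (comp L 2) (comp L' 2))
          (.cons (.cons (comp L 4) (comp L' 4)) (.snd (.snd (.fst c))))))
        (.snd globals)))))
    (.cons (.call fWeight (.cons L' (.fst (.snd c)))) (.cons L' (.snd (.snd c))))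

/-- The entries of the lightest strings, for all keys, among the strings given by the list of pairs
of a layer `L'` and an entry; the parameter is `(globals, L)`. -/
def extendBody : Expr :=
  foldBody fExtend .nil
    (.ite (fits (.snd par) (.fst head) (.fst (.fst (.snd head))))
      (.call fInsert (.cons (nextEntry (.fst par) (.snd par) (.fst head) (.snd head)) acc))
      acc)

/-- The entries of the lightest strings in the place of the string of layers given as the list, for
all keys; the parameter is `((globals, layers), c)` with the entry `c` of the empty string. -/
def solveBody : Expr :=
  foldBody fSolve (.cons (.snd (.fst arg)) .nil)
    (.call fExtend (.cons (.cons (.fst (.fst par)) head)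
      (.call fPairs (.cons acc (.snd (.fst par))))))

/-- An entry of least weight among those whose initial states are equivalent to the parameter, with
its key removed; a list of length at most one. -/
def chooseBody : Expr :=
  foldBody fChoose .nil
    (.ite
      (.call fMem (.cons (.cons par (.fst (.snd (.fst head)))) (.snd (.snd (.fst head)))))
      (.call fInsert (.cons (.cons .nil (.snd head)) acc))
      acc)

/-- All lists of bits of a length given as a unary number. -/
def subsetsBody : Expr :=
  foldBody fSubsets (.cons .nil .nil)
    (.call fPairs (.cons acc (.cons .nil (.cons one .nil))))

/-- Copies of the parameter, of a number given in unary. -/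
def replicateBody : Expr :=
  foldBody fReplicate .nil (.cons par acc)

/-- Adds the number of bits set in the list to the parameter. -/
def countBody : Expr :=
  foldBody fCount (.fst arg) (.ite head (.cons .nil acc) acc)

/-- Adds the number of bits set in a list of lists to the parameter. -/
def countRowsBody : Expr :=
  foldBody fCountRows (.fst arg) (.call fCount (.cons acc head))

/-- Adds the number of bits set in a list of lists of lists to the parameter. -/
def countTableBody : Expr :=
  foldBody fCountTable (.fst arg) (.call fCountRows (.cons acc head))

/-- The maximum of two unary numbers. -/
def maxBody : Expr :=
  .ite (.call fSub arg) (.fst arg) (.snd arg)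

/-- The list of the entries of the solutions, of length at most one, for the input
`(|Σ|, w, D, layers)`. The variables bound on the way are the empty set, the list of all sets and
the list of all pairs of sets. -/
def search : Expr :=
  .letIn (.call fReplicate (.cons .nil (.fst (.snd arg))))
    (.letIn (.call fSubsets (.cons .nil (.fst (.snd (.var 1)))))
      (.letIn (.call fPairs (.cons (.var 0) (.var 0)))
        (.call fChoose (.cons
          (comp (.fst (.fst (.snd (.snd (.var 3))))) 3)
          (.call fSolve (.cons
            (.cons
              (.cons
                (.cons (.call fReplicate (.cons (.var 2) (.fst (.var 3)))) (.var 0))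
                (.fst (.snd (.snd (.snd (.var 3))))))
              (.cons (.cons (.var 2) (.cons (.var 2) (.var 0))) (.cons .nil .nil)))
            (.fst (.snd (.snd (.var 3))))))))))

/-- Whether there is a solution. -/
def decideBody : Expr := .ite search one .nil

/-- The string of layers of the solution. -/
def optimumBody : Expr := .snd (.snd (.fst search))

end Prog

open Prog

/-- The program with a given main function and a given function that maps `(L, n)` to the weight
of a string with first layer `L` and tail of weight `n`. -/
def prog (main weight : Expr) : Program :=
  [main, eqBody, zipBody, orBody, orRowsBody, postBody, meetsBody, memBody, checkBody, filterBody,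
    subBody, insertBody, pairWithBody, pairsBody, extendBody, solveBody, chooseBody, subsetsBody,
    replicateBody, weight, countBody, countRowsBody, countTableBody, maxBody]

/-! ### Running times of the functions on lists -/

/-- The number of nodes of a tree, counting empty trees. -/
def Data.size : Data → ℕ
  | .nil => 1
  | .cons a b => a.size + b.size + 1

/-- The list of the truth values of `f` on the list `qs`. -/
def bits {ι : Type*} (f : ι → Bool) (qs : List ι) : Data := .ofList (qs.map fun q => .ofBool (f q))

section ListFunctions

variable {main wt : Expr} {ι κ : Type*}

theorem calls_eq (x y : Data) :
    Calls (prog main wt) fEq (.cons x y) (.ofBool (decide (x = y))) (200 * x.size) := by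
  induction x generalizing y with
  | nil =>
    cases y with
    | nil =>
      exact .intro (e := eqBody) rfl (.conv
        (.iteNil (.access rfl) (.iteNil (.access rfl) (.access rfl)))
        (by simp [Data.ofBool]) (by simp [Data.size]))
    | cons c d =>
      exact .intro (e := eqBody) rfl (.conv
        (.iteNil (.access rfl) (.iteCons (.access rfl) (.access rfl)))
        (by simp [Data.ofBool]) (by simp [Data.size]))
  | cons a b iha ihb =>
    cases y with
    | nil =>
      exact .intro (e := eqBody) rfl (.conv
        (.iteCons (.access rfl) (.iteNil (.access rfl) (.access rfl)))
        (by simp [Data.ofBool]) (by simp only [Data.size]; omega))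
    | cons c d =>
      exact .intro (e := eqBody) rfl (.conv (.iteCons (.access rfl) (.iteCons (.access rfl)
        (.ite (.call (iha c) (.access rfl)) (fun _ => .call (ihb d) (.access rfl))
          fun _ => .access rfl)))
        (by by_cases h : a = c <;> simp [Data.ofBool, h]) (by simp only [Data.size]; omega))

theorem calls_zip (f g : ι → Data) (qs : List ι) :
    Calls (prog main wt) fZip (.cons (.ofList (qs.map f)) (.ofList (qs.map g)))
      (.ofList (qs.map fun q => .cons (f q) (g q))) (200 * (qs.length + 1)) := by
  induction qs with
  | nil => exact .intro (e := zipBody) rfl (.mono (.iteNil (.access rfl) (.access rfl)) (by simp))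
  | cons q qs ih =>
    refine .intro (e := zipBody) rfl
      (.mono (.iteCons (.access rfl) (.cons (.access rfl) (.call ih (.access rfl)))) ?_)
    rw [List.length_cons]
    omega

theorem calls_or (f g : ι → Bool) (qs : List ι) :
    Calls (prog main wt) fOr
      (.cons .nil (.ofList (qs.map fun q => .cons (.ofBool (f q)) (.ofBool (g q)))))
      (bits (fun q => f q || g q) qs) (300 * (qs.length + 1)) := by
  refine .fold rfl _ (bits fun q => f q || g q) qs (.mono (.access rfl) (by simp)) fun q qs _ => ?_
  refine .conv (.cons (.ite (q := f q) (.access rfl) (fun _ => .access rfl) fun _ => .access rfl)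
    (.access rfl)) ?_ (by simp)
  cases h : f q <;> simp [bits, h, Data.ofList, Data.ofBool, Data.fst, Data.snd]

theorem calls_orRows (F G : κ → ι → Bool) (qs : List ι) (as : List κ) :
    Calls (prog main wt) fOrRows
      (.cons .nil (.ofList (as.map fun a => .cons (bits (F a) qs) (bits (G a) qs))))
      (.ofList (as.map fun a => bits (fun q => F a q || G a q) qs))
      ((500 * (qs.length + 1) + 300) * (as.length + 1)) := by
  refine .fold rfl _ (fun as => .ofList (as.map fun a => bits (fun q => F a q || G a q) qs)) as
    (.mono (.access rfl) (by omega)) fun a as _ => ?_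
  exact .mono (.cons (.call (calls_or (F a) (G a) qs) (.cons (.access rfl)
    (.call (calls_zip _ _ qs) (.access rfl)))) (.access rfl)) (by omega)

theorem calls_post (A : ι → Bool) (T : ι → κ → ι → Bool) (qs : List ι) (as : List κ)
    (ps : List ι) :
    Calls (prog main wt) fPost
      (.cons (.ofList (as.map fun _ => bits (fun _ => false) qs))
        (.ofList (ps.map fun p => .cons (.ofBool (A p))
          (.ofList (as.map fun a => bits (T p a) qs)))))
      (.ofList (as.map fun a => bits (fun q => ps.any fun p => A p && T p a q) qs))
      (((500 * (qs.length + 1) + 500) * (as.length + 1) + 400) * (ps.length + 1)) := by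
  refine .fold rfl _
    (fun ps => .ofList (as.map fun a => bits (fun q => ps.any fun p => A p && T p a q) qs)) ps
    (.mono (.access rfl) (by omega)) fun p ps _ => ?_
  refine .conv (.ite (q := A p) (.access rfl) (fun _ => .call
    (calls_orRows (T p) (fun a q => ps.any fun p => A p && T p a q) qs as)
    (.cons (.access rfl) (.call (calls_zip _ _ as) (.access rfl)))) fun _ => .access rfl)
    ?_ ?_
  · cases h : A p <;> simp [h]
  · simp only [Nat.add_mul]
    omega

theorem calls_meets (f g : ι → Bool) (qs : List ι) :
    Calls (prog main wt) fMeets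
      (.cons .nil (.ofList (qs.map fun q => .cons (.ofBool (f q)) (.ofBool (g q)))))
      (.ofBool (qs.any fun q => f q && g q)) (300 * (qs.length + 1)) := by
  refine .fold rfl _ (fun qs => .ofBool (qs.any fun q => f q && g q)) qs
    (.mono (.access rfl) (by simp)) fun q qs _ => ?_
  refine .conv (.ite (q := f q) (.access rfl)
    (fun _ => .ite (q := g q) (.access rfl) (fun _ => .access rfl) fun _ => .access rfl)
    fun _ => .access rfl) ?_ (by simp)
  cases h : f q <;> cases h' : g q <;> simp [h, h', Data.ofBool]

theorem calls_mem (x : Data) (l : List Data) :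
    Calls (prog main wt) fMem (.cons x (.ofList l)) (.ofBool (decide (x ∈ l)))
      ((200 * x.size + 300) * (l.length + 1)) := by
  have h := Calls.fold (P := prog main wt) (p := x) (C := 200 * x.size + 200) (f := fMem) rfl id
    (fun l => .ofBool (decide (x ∈ l))) l (.conv (.access rfl) (by simp [Data.ofBool]) (by omega))
    fun y ys _ => .conv (.ite (.call (calls_eq x y) (.access rfl)) (fun _ => .access rfl)
      fun _ => .access rfl) (by by_cases h : x = y <;> simp [h, Data.ofBool]) (by omega)
  rwa [List.map_id] at h

theorem calls_sub (a b : ℕ) :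
    Calls (prog main wt) fSub (.cons (.ofNat a) (.ofNat b)) (.ofNat (a - b)) (300 * (b + 1)) := by
  refine .foldNat rfl (fun b => .ofNat (a - b)) b (.mono (.access rfl) (by simp)) fun m _ => ?_
  refine .conv (.access rfl) ?_ (by simp)
  rcases h : a - m with _ | n
  · simp [show a - (m + 1) = 0 by omega, Data.ofNat, Data.ofList, Data.snd]
  · simp [show a - (m + 1) = n by omega, Data.ofNat, Data.ofList, Data.snd, List.replicate_succ]

theorem calls_replicate (x : Data) (n : ℕ) :
    Calls (prog main wt) fReplicate (.cons x (.ofNat n)) (.ofList (List.replicate n x))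
      (300 * (n + 1)) :=
  .foldNat rfl (fun n => .ofList (List.replicate n x)) n (.mono (.access rfl) (by simp))
    fun _ _ => .mono (.access rfl) (by simp)

theorem calls_pairWith (f : ι → Data) (x : Data) (acc : List Data) (l : List ι) :
    Calls (prog main wt) fPairWith (.cons (.cons x (.ofList acc)) (.ofList (l.map f)))
      (.ofList (l.map (fun b => .cons x (f b)) ++ acc)) (300 * (l.length + 1)) :=
  .fold rfl _ (fun l => .ofList (l.map (fun b => .cons x (f b)) ++ acc)) l
    (.mono (.access rfl) (by simp)) fun _ _ _ => .mono (.access rfl) (by simp)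

theorem calls_pairs (f : ι → Data) (g : κ → Data) (l : List ι) (l' : List κ) :
    Calls (prog main wt) fPairs (.cons (.ofList (l'.map g)) (.ofList (l.map f)))
      (.ofList ((l.product l').map fun q => .cons (f q.1) (g q.2)))
      ((300 * (l'.length + 1) + 400) * (l.length + 1)) := by
  refine .fold (C := 300 * (l'.length + 1) + 300) rfl _
    (fun l => .ofList ((l.product l').map fun q => .cons (f q.1) (g q.2))) l
    (.mono (.access rfl) (by omega)) fun a l _ => ?_
  exact .conv (.call (calls_pairWith g (f a) _ l') (.access rfl))
    (by simp [List.product, Function.comp_def, List.map_flatMap]) (by omega)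

/-- All lists of bits of a given length. -/
def bitLists : ℕ → List (List Bool)
  | 0 => [[]]
  | n + 1 => ([false, true].product (bitLists n)).map fun q => q.1 :: q.2

theorem length_bitLists (n : ℕ) : (bitLists n).length = 2 ^ n := by
  induction n with
  | zero => rfl
  | succ n ih =>
    exact (List.length_map _).trans ((List.length_product _ _).trans (by simp [ih, pow_succ']))

theorem calls_bitLists (n : ℕ) :
    Calls (prog main wt) fSubsets (.cons .nil (.ofNat n))
      (.ofList ((bitLists n).map (bits id))) ((900 * 2 ^ n + 2400) * (n + 1)) := by
  refine .foldNat rfl (fun n => .ofList ((bitLists n).map (bits id))) n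
    (.mono (.access rfl) (by omega)) fun m hm => ?_
  refine .conv (.call (calls_pairs .ofBool (bits id) [false, true] (bitLists m)) (.access rfl))
    ?_ ?_
  · simp [bitLists, Function.comp_def, bits, Data.ofList]
  · have := Nat.pow_lt_pow_right one_lt_two hm
    rw [length_bitLists]
    simp only [List.length_cons, List.length_nil]
    omega

end ListFunctions

/-! ### Encodings of sets, pairs of sets and keys -/

section Encodings

theorem Data.ofBool_injective : Function.Injective Data.ofBool := by
  rintro (_ | _) (_ | _) h <;> simp_all [Data.ofBool]

theorem Data.ofList_injective : Function.Injective Data.ofList := by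
  intro l l' h
  induction l generalizing l' with
  | nil => cases l' <;> simp_all [Data.ofList]
  | cons a l ih =>
    cases l' with
    | nil => simp [Data.ofList] at h
    | cons b l' =>
      obtain ⟨rfl, htail⟩ := Data.cons.inj h
      rw [ih htail]

theorem Data.size_ofList_map_le {ι : Type*} {f : ι → Data} {C : ℕ} (h : ∀ x, (f x).size ≤ C)
    (l : List ι) : (Data.ofList (l.map f)).size ≤ (C + 1) * l.length + 1 := by
  induction l with
  | nil => simp [Data.ofList, Data.size]
  | cons a l ih =>
    simp only [List.map_cons, Data.ofList, Data.size, List.length_cons]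
    linarith [h a]

theorem encodeStates_injective : Function.Injective (encodeStates (w := w)) := by
  intro A A' h
  have h := List.map_inj_left.1 (Data.ofList_injective h)
  ext p
  simpa using Data.ofBool_injective (h p (List.mem_finRange p))

theorem size_encodeStates_le (A : Finset (Fin w)) : (encodeStates A).size ≤ 4 * w + 1 := by
  have h := Data.size_ofList_map_le (f := fun p => .ofBool (decide (p ∈ A))) (C := 3)
    (fun p => by cases decide (p ∈ A) <;> simp [Data.ofBool, Data.size]) (List.finRange w)
  rwa [List.length_finRange] at h

theorem mem_bitLists {b : List Bool} {n : ℕ} : b ∈ bitLists n ↔ b.length = n := by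
  induction n generalizing b with
  | zero => simp [bitLists]
  | succ n ih =>
    cases b with
    | nil => simp [bitLists]
    | cons x b => cases x <;> simp [bitLists, List.product, ih]

/-- The set of states with a given list of membership bits. -/
def ofBits (w : ℕ) (b : List Bool) : Finset (Fin w) := Finset.univ.filter fun p => b.getD p false

theorem encodeStates_ofBits {b : List Bool} (hb : b.length = w) :
    encodeStates (ofBits w b) = bits id b := by
  subst hb
  refine congrArg Data.ofList (List.ext_getElem (by simp) fun i h h' => ?_)
  simp_all [ofBits]

/-- All sets of states, in the order in which the program lists them. -/
def subsets (w : ℕ) : List (Finset (Fin w)) := (bitLists w).map (ofBits w)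

theorem length_subsets : (subsets w).length = 2 ^ w := by
  rw [subsets, List.length_map, length_bitLists]

theorem map_encodeStates_subsets : (subsets w).map encodeStates = (bitLists w).map (bits id) := by
  rw [subsets, List.map_map]
  exact List.map_congr_left fun b hb => encodeStates_ofBits (mem_bitLists.1 hb)

theorem mem_subsets (A : Finset (Fin w)) : A ∈ subsets w := by
  have h : bits id ((List.finRange w).map fun p => decide (p ∈ A)) = encodeStates A := by
    rw [bits, List.map_map]
    rfl
  have hlen : ((List.finRange w).map fun p => decide (p ∈ A)).length = w := by simp
  exact List.mem_map.2 ⟨_, mem_bitLists.2 hlen,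
    encodeStates_injective ((encodeStates_ofBits hlen).trans h)⟩

/-- All pairs of sets of states, in the order in which the program lists them. -/
def statePairs (w : ℕ) : List (Finset (Fin w) × Finset (Fin w)) := (subsets w).product (subsets w)

theorem length_statePairs : (statePairs w).length = 2 ^ w * 2 ^ w := by
  rw [← length_subsets]
  exact List.length_product _ _

/-- A pair of sets of states as data. -/
def encodePair (q : Finset (Fin w) × Finset (Fin w)) : Data :=
  .cons (encodeStates q.1) (encodeStates q.2)

theorem encodePair_injective : Function.Injective (encodePair (w := w)) := by
  intro q q' h
  obtain ⟨h, h'⟩ := Data.cons.inj h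
  exact Prod.ext (encodeStates_injective h) (encodeStates_injective h')

theorem size_encodePair_le (q : Finset (Fin w) × Finset (Fin w)) :
    (encodePair q).size ≤ 8 * w + 3 := by
  have h := size_encodeStates_le q.1
  have h' := size_encodeStates_le q.2
  rw [encodePair, Data.size]
  omega

/-- The list of the elements of a set of pairs of sets of states. -/
def pairList (E : Set (Finset (Fin w) × Finset (Fin w))) : List (Finset (Fin w) × Finset (Fin w)) :=
  (statePairs w).filter fun q => q ∈ E

variable {E : Set (Finset (Fin w) × Finset (Fin w))}

theorem mem_pairList {q : Finset (Fin w) × Finset (Fin w)} : q ∈ pairList E ↔ q ∈ E := by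
  rw [pairList, List.mem_filter, decide_eq_true_iff]
  exact and_iff_right (List.pair_mem_product.2 ⟨mem_subsets _, mem_subsets _⟩)

theorem length_pairList_le : (pairList E).length ≤ 2 ^ w * 2 ^ w :=
  (List.length_filter_le _ _).trans_eq length_statePairs

/-- A key as data. -/
def encodeKey (K : Key w) : Data :=
  .cons (encodeStates K.frontier)
    (.cons (encodeStates K.init) (.ofList ((pairList K.equiv).map encodePair)))

theorem encodeKey_injective : Function.Injective (encodeKey (w := w)) := by
  intro K K' h
  obtain ⟨hfrontier, h⟩ := Data.cons.inj h
  obtain ⟨hinit, hequiv⟩ := Data.cons.inj h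
  have hequiv := (List.map_injective_iff.2 encodePair_injective) (Data.ofList_injective hequiv)
  refine Key.ext (encodeStates_injective hfrontier) (encodeStates_injective hinit)
    (Set.ext fun q => ?_)
  rw [← mem_pairList, hequiv, mem_pairList]

theorem size_encodeKey_le (K : Key w) :
    (encodeKey K).size ≤ (8 * w + 4) * (2 ^ w * 2 ^ w + 2) := by
  have hfrontier := size_encodeStates_le K.frontier
  have hinit := size_encodeStates_le K.init
  have hequiv := Data.size_ofList_map_le size_encodePair_le (pairList K.equiv)
  have hlen := Nat.mul_le_mul_left (8 * w + 4) (length_pairList_le (E := K.equiv))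
  simp only [encodeKey, Data.size]
  linarith

end Encodings

/-! ### Running times of the functions on layers -/

/-- The set of letters and the sets of sets of states, of pairs of them and of keys are small in
comparison with `B`, and so are the constants in the running times. -/
structure IsBudget (α : Type*) [Fintype α] (w B : ℕ) : Prop where
  const_le : 4096 ≤ B
  states_lt : w < B
  letters_lt : Fintype.card α < B
  pairs_lt : 2 ^ w * 2 ^ w < B
  keys_lt : keyCount w < B

section LayerFunctions

theorem two_pow_lt [Fintype α] {B : ℕ} (hB : IsBudget α w B) : 2 ^ w < B :=
  (Nat.le_mul_of_pos_right _ (Nat.two_pow_pos w)).trans_lt hB.pairs_lt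

theorem fold_time_le {B C M T X n : ℕ} (hB : 4096 ≤ B) (hC : C + 100 ≤ 4096 * X) (hn : n < M)
    (hT : B * M * X = T) : (C + 100) * (n + 1) ≤ T :=
  calc (C + 100) * (n + 1) ≤ 4096 * X * M := Nat.mul_le_mul hC hn
    _ ≤ B * X * M := by gcongr
    _ = T := by rw [← hT, Nat.mul_right_comm]

theorem mul_le_pow_four {B : ℕ} (hB : 4096 ≤ B) : 4096 * B ≤ B ^ 4 :=
  calc 4096 * B ≤ B * B := Nat.mul_le_mul_right B hB
    _ = B ^ 2 := (sq B).symm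
    _ ≤ B ^ 4 := Nat.pow_le_pow_right (by omega) (by decide)

theorem post_time_le [Fintype α] {B : ℕ} (hB : IsBudget α w B) :
    ((500 * (w + 1) + 500) * (Fintype.card α + 1) + 400) * (w + 1) ≤ B ^ 4 := by
  refine fold_time_le (X := B ^ 2) hB.const_le ?_ hB.states_lt (by ring)
  have hrow : (w + 1) * (Fintype.card α + 1) ≤ B * B := Nat.mul_le_mul hB.states_lt hB.letters_lt
  nlinarith [hB.letters_lt, hB.const_le]

theorem pairs_time_le [Fintype α] {B m n : ℕ} (hB : IsBudget α w B) (hm : m < B) (hn : n < B) :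
    (300 * (m + 1) + 400) * (n + 1) ≤ B ^ 3 :=
  fold_time_le (X := B) hB.const_le (by linarith [hB.const_le]) hn (by ring)

theorem length_solve_lt [Fintype α] {B : ℕ} {stp : Layer α w → ℕ → ℕ}
    {l D : List (Layer α w)} (hB : IsBudget α w B) : (solve stp l D).length < B :=
  (length_le_keyCount nodup_map_key_solve).trans_lt hB.keys_lt

variable {main wt : Expr} {env : List Data} {B : ℕ}

theorem bits_eq_encodeStates {f : Fin w → Bool} {A : Finset (Fin w)}
    (h : ∀ p, f p = true ↔ p ∈ A) : bits f (List.finRange w) = encodeStates A := by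
  refine congrArg Data.ofList (List.map_congr_left fun p _ => congrArg _ ?_)
  rw [Bool.eq_iff_iff, h, decide_eq_true_iff]

theorem within_meets {a b : Expr} {A F : Finset (Fin w)} {s t : ℕ}
    (ha : Within (prog main wt) env a (encodeStates A) s)
    (hb : Within (prog main wt) env b (encodeStates F) t) :
    Within (prog main wt) env (meets a b) (.ofBool (decide (A ∩ F).Nonempty))
      (s + t + 600 * (w + 1)) := by
  have hcall := calls_meets (main := main) (wt := wt) (fun p => decide (p ∈ A))
    (fun p => decide (p ∈ F)) (List.finRange w)
  have hzip := calls_zip (main := main) (wt := wt) (fun p => .ofBool (decide (p ∈ A)))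
    (fun p => .ofBool (decide (p ∈ F))) (List.finRange w)
  rw [List.length_finRange] at hcall hzip
  refine (Within.call hcall (.cons (.access rfl) (.call hzip (.cons ha hb)))).conv
    (congrArg Data.ofBool ?_) (by omega)
  rw [Bool.eq_iff_iff]
  simp [Finset.Nonempty]

variable [Fintype α]

section

variable (L L' : Layer α w) (E : Set (Finset (Fin w) × Finset (Fin w)))

variable {E} in
theorem calls_mem_pairList (hB : IsBudget α w B) (q : Finset (Fin w) × Finset (Fin w)) :
    Calls (prog main wt) fMem (.cons (encodePair q) (.ofList ((pairList E).map encodePair)))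
      (.ofBool (decide (q ∈ E))) (1600 * B ^ 2) := by
  refine (calls_mem (encodePair q) _).conv ?_ ?_
  · simp only [List.mem_map_of_injective encodePair_injective, mem_pairList]
  · rw [pow_two, ← mul_assoc, List.length_map]
    exact Nat.mul_le_mul (by linarith [hB.states_lt, size_encodePair_le q])
      ((Nat.succ_le_succ length_pairList_le).trans hB.pairs_lt)

/-- The parameter of the function that checks pairs of sets of states. -/
def encodeCheck : Data :=
  .cons (.cons (encodeStates L.fin) (encodeStates L'.fin))
    (.ofList ((pairList E).map encodePair))

theorem within_agrees {x χ : Expr} {q : Finset (Fin w) × Finset (Fin w)} (hB : IsBudget α w B)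
    (hx : Within (prog main wt) env x (encodePair q) 40)
    (hχ : Within (prog main wt) env χ (encodeCheck L L' E) 40) :
    Within (prog main wt) env (agrees x χ) (.ofBool (decide (Agree L L' E q))) (4000 * B ^ 2) := by
  refine (Within.ite (.call (calls_eq _ _)
    (.cons (within_meets hx.fst hχ.fst.fst) (within_meets hx.snd hχ.fst.snd)))
    (fun _ => .call (calls_mem_pairList hB q) (.cons hx hχ.snd))
    (fun _ => .access (v := .nil) rfl)).conv ?_ ?_
  · simp only [Data.ofBool_injective.eq_iff, decide_eq_decide, decide_eq_true_iff, Agree]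
    by_cases h : (q.1 ∩ L.fin).Nonempty ↔ (q.2 ∩ L'.fin).Nonempty <;> simp [h, Data.ofBool]
  · have : (Data.ofBool (decide (q.1 ∩ L.fin).Nonempty)).size ≤ 3 := by
      cases decide (q.1 ∩ L.fin).Nonempty <;> simp [Data.ofBool, Data.size]
    have := hB.states_lt
    have := Nat.mul_le_mul_right B hB.const_le
    rw [max_eq_left (by omega)]
    nlinarith

theorem calls_check (hB : IsBudget α w B) (qs : List (Finset (Fin w) × Finset (Fin w)))
    (hqs : qs.length < B) :
    Calls (prog main wt) fCheck (.cons (encodeCheck L L' E) (.ofList (qs.map encodePair)))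
      (.ofBool (decide (∀ q ∈ qs, Agree L L' E q))) (B ^ 4) := by
  have hconst : 4096 ≤ B ^ 2 := hB.const_le.trans (Nat.le_self_pow two_ne_zero B)
  refine (Calls.fold (C := 4000 * B ^ 2 + 100) rfl encodePair
    (fun qs => .ofBool (decide (∀ q ∈ qs, Agree L L' E q))) qs
    (.conv (.access rfl) (by simp [Data.ofBool]) (by omega)) fun q qs _ => ?_).mono
    (fold_time_le hB.const_le (X := B ^ 2) (by omega) hqs (by ring))
  refine .conv (.ite (within_agrees L L' E hB (.access rfl) (.access rfl)) (fun _ => .access rfl)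
    fun _ => .access rfl) ?_ (by omega)
  by_cases h : Agree L L' E q <;> simp [h, Data.ofBool]

end

theorem calls_subsets (hB : IsBudget α w B) :
    Calls (prog main wt) fSubsets (.cons .nil (.ofNat w))
      (.ofList ((subsets w).map encodeStates)) (B ^ 3) := by
  rw [map_encodeStates_subsets]
  have := two_pow_lt hB
  exact (calls_bitLists w).mono (fold_time_le (C := 900 * 2 ^ w + 2300) hB.const_le (X := B)
    (by linarith [hB.const_le]) hB.states_lt (by ring))

theorem calls_statePairs (hB : IsBudget α w B) :
    Calls (prog main wt) fPairs
      (.cons (.ofList ((subsets w).map encodeStates)) (.ofList ((subsets w).map encodeStates)))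
      (.ofList ((statePairs w).map encodePair)) (B ^ 3) := by
  have hlen : (subsets w).length < B := length_subsets.trans_lt (two_pow_lt hB)
  exact (calls_pairs encodeStates encodeStates (subsets w) (subsets w)).mono
    (pairs_time_le hB hlen hlen)

variable [LinearOrder α]

/-- A table with a bit for every letter and state. -/
def encodeRows (A : α → Finset (Fin w)) : Data :=
  .ofList ((letters α).map fun a => encodeStates (A a))

theorem length_letters : (letters α).length = Fintype.card α := Finset.length_sort _

theorem mem_letters (a : α) : a ∈ letters α := (Finset.mem_sort _).2 (Finset.mem_univ a)

theorem within_successors {z a t : Expr} {A : Finset (Fin w)} {T : Finset (Fin w × α × Fin w)}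
    (hB : IsBudget α w B)
    (hz : Within (prog main wt) env z (encodeRows fun _ : α => (∅ : Finset (Fin w))) 40)
    (ha : Within (prog main wt) env a (encodeStates A) 40)
    (ht : Within (prog main wt) env t (encodeTransitions T) 40) :
    Within (prog main wt) env (successors z a t) (encodeRows (post T A)) (2 * B ^ 4) := by
  have hcall := calls_post (main := main) (wt := wt) (fun p => decide (p ∈ A))
    (fun p a q => decide ((p, a, q) ∈ T)) (List.finRange w) (letters α) (List.finRange w)
  have hempty : bits (fun _ => false) (List.finRange w) = encodeStates ∅ :=
    bits_eq_encodeStates (by simp)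
  have hrow (a : α) : bits (fun q => (List.finRange w).any fun p => decide (p ∈ A) &&
      decide ((p, a, q) ∈ T)) (List.finRange w) = encodeStates (post T A a) :=
    bits_eq_encodeStates (by simp [mem_post])
  simp only [hempty, hrow, List.length_finRange, length_letters] at hcall
  refine (Within.call hcall (.cons hz (.call (calls_zip _ _ _) (.cons ha ht)))).mono ?_
  have htime := post_time_le hB
  have hstates := hB.states_lt
  have hconst := mul_le_pow_four hB.const_le
  rw [List.length_finRange]
  linarith

variable (L L' : Layer α w)

theorem calls_filter (hB : IsBudget α w B) (K : Key w) :
    Calls (prog main wt) fFilter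
      (.cons (.cons (encodeRows fun _ : α => (∅ : Finset (Fin w)))
        (.cons (.cons (encodeTransitions L.trans) (encodeTransitions L'.trans))
          (encodeCheck L L' K.equiv))) (.ofList ((statePairs w).map encodePair)))
      (.ofList ((pairList (K.next L L').equiv).map encodePair)) (B ^ 6) := by
  have hconst : 4096 ≤ B ^ 4 := hB.const_le.trans (Nat.le_self_pow four_ne_zero B)
  refine (Calls.fold (C := 300 * B ^ 4 + 1000) rfl encodePair
    (fun qs => .ofList ((qs.filter fun q => q ∈ (K.next L L').equiv).map encodePair)) (statePairs w)
    (.mono (.access rfl) (by omega)) fun q qs _ => ?_).mono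
    (fold_time_le hB.const_le (X := B ^ 4) (by omega)
      (length_statePairs.trans_lt hB.pairs_lt) (by ring))
  have hcheck := calls_check (main := main) (wt := wt) L L' K.equiv hB
    ((letters α).map fun a => (post L.trans q.1 a, post L'.trans q.2 a))
    (by rw [List.length_map, length_letters]; exact hB.letters_lt)
  rw [List.map_map] at hcheck
  have hzip := calls_zip (main := main) (wt := wt) (fun a => encodeStates (post L.trans q.1 a))
    (fun a => encodeStates (post L'.trans q.2 a)) (letters α)
  refine .conv (.ite (.call hcheck (.cons (.access rfl) (.call hzip (.cons
    (within_successors hB (.access rfl) (.access rfl) (.access rfl))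
    (within_successors hB (.access rfl) (.access rfl) (.access rfl))))))
    (fun _ => .access rfl) fun _ => .access rfl) ?_ ?_
  · have hK : (∀ p ∈ (letters α).map fun a => (post L.trans q.1 a, post L'.trans q.2 a),
        Agree L L' K.equiv p) ↔ q ∈ (K.next L L').equiv := by simp [mem_letters]
    by_cases h : q ∈ (K.next L L').equiv
    · rw [decide_eq_true (hK.2 h), List.filter_cons, if_pos (decide_eq_true h)]
      rfl
    · rw [decide_eq_false (mt hK.1 h), List.filter_cons, if_neg (mt of_decide_eq_true h)]
      rfl
  · have := hB.letters_lt
    have := Nat.le_self_pow four_ne_zero B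
    rw [length_letters]
    omega

end LayerFunctions

/-! ### Running time of the search -/

section Search

variable {main wt : Expr} {env : List Data}

/-- The entry of `b` in the lists of lightest elements, with its key `κ b`, its weight `μ b` and its
value `π b`. -/
def encodeEntry {β γ : Type*} (enc : γ → Data) (κ : β → γ) (μ : β → ℕ) (π : β → Data) (b : β) :
    Data :=
  .cons (enc (κ b)) (.cons (.ofNat (μ b)) (π b))

theorem within_lighter {β γ : Type*} {enc : γ → Data} {κ : β → γ} {μ : β → ℕ} {π : β → Data}
    {b d : β} {x y : Expr} {s t : ℕ}
    (hx : Within (prog main wt) env x (encodeEntry enc κ μ π b) s)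
    (hy : Within (prog main wt) env y (encodeEntry enc κ μ π d) t) :
    Within (prog main wt) env (lighter x y) (encodeEntry enc κ μ π (if μ b ≤ μ d then b else d))
      (2 * s + 2 * t + 300 * (μ d + 1) + 10) := by
  have hsub := Within.call (calls_sub (main := main) (wt := wt) (μ b) (μ d))
    (.cons hx.snd.fst hy.snd.fst)
  rcases h : μ b - μ d with _ | n <;> rw [h] at hsub
  · rw [if_pos (by omega)]
    exact (Within.iteNil hsub hx).mono (by omega)
  · rw [if_neg (by omega)]
    exact (Within.iteCons hsub hy).mono (by omega)

theorem calls_insert {β γ : Type*} {enc : γ → Data} {κ : β → γ} {μ : β → ℕ} (π : β → Data)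
    (henc : Function.Injective enc) {b : β} {ds : List β} {s W : ℕ} (hs : (enc (κ b)).size ≤ s)
    (hW : ∀ d ∈ ds, μ d ≤ W) :
    Calls (prog main wt) fInsert
      (.cons (encodeEntry enc κ μ π b) (.ofList (ds.map (encodeEntry enc κ μ π))))
      (.ofList ((insertLightest κ μ b ds).map (encodeEntry enc κ μ π)))
      ((200 * s + 300 * (W + 1) + 600) * (ds.length + 1)) := by
  refine .fold (C := 200 * s + 300 * (W + 1) + 500) rfl _
    (fun ds => .ofList ((insertLightest κ μ b ds).map (encodeEntry enc κ μ π))) ds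
    (.mono (.access rfl) (by omega)) fun d ds hds => ?_
  have hd := hW d (hds.subset List.mem_cons_self)
  refine .conv (.ite (.call (calls_eq (enc (κ b)) (enc (κ d))) (.access rfl))
    (fun _ => .cons (within_lighter (b := b) (d := d) (.access rfl) (.access rfl)) (.access rfl))
    fun _ => .access rfl) ?_ (by omega)
  by_cases h : κ b = κ d
  · simp only [h, insertLightest, decide_true, if_true]
    rfl
  · simp only [henc.eq_iff, h, insertLightest, decide_false, if_false]
    rfl

theorem within_comp {e : Expr} {ds : List Data} {t : ℕ}
    (h : Within (prog main wt) env e (.ofList ds) t) (i : ℕ) :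
    Within (prog main wt) env (comp e i) (ds.getD i .nil) (t + i + 1) := by
  induction i generalizing e ds t with
  | zero => cases ds <;> exact h.fst
  | succ i ih =>
    cases ds with
    | nil => exact (ih (ds := []) h.snd).mono (by omega)
    | cons d ds => exact (ih (ds := ds) h.snd).mono (by omega)

variable [Fintype α] [LinearOrder α] {L L' : Layer α w} {A : Finset (Fin w)} {B : ℕ}

theorem within_fits {l l' a : Expr} (hl : Within (prog main wt) env l (encodeLayer L) 40)
    (hl' : Within (prog main wt) env l' (encodeLayer L') 40)
    (ha : Within (prog main wt) env a (encodeStates A) 40) :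
    Within (prog main wt) env (fits l l' a) (.ofBool (decide (Fits L L' A))) (2000 * (w + 1)) := by
  have hsize (q : Bool) : (Data.ofBool q).size ≤ 3 := by cases q <;> simp [Data.ofBool, Data.size]
  have hinit := hsize L'.initFlag
  have hfin := hsize L'.finFlag
  have hright := size_encodeStates_le L'.right
  refine .conv (.ite (.call (calls_eq (.ofBool L'.initFlag) (.ofBool L.initFlag))
      (.cons (within_comp hl' 5) (within_comp hl 5)))
    (fun _ => .ite (.call (calls_eq (.ofBool L'.finFlag) (.ofBool L.finFlag))
        (.cons (within_comp hl' 6) (within_comp hl 6)))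
      (fun _ => .ite (q := L.finFlag) (within_comp hl 6)
        (fun _ => .access (v := .ofBool true) rfl)
        fun _ => .call (calls_eq (encodeStates L'.right) (encodeStates A))
          (.cons (within_comp hl' 1) ha))
      fun _ => .access (v := .ofBool false) rfl)
    fun _ => .access (v := .ofBool false) rfl) ?_ (by omega)
  simp only [Data.ofBool_injective.eq_iff, encodeStates_injective.eq_iff, ← apply_ite Data.ofBool]
  rw [Bool.eq_iff_iff, decide_eq_true_iff (p := Fits L L' A)]
  simp [Fits]

/-- The entry of the string of layers `c` in the place of `D`. -/
def encodeCandidate (stp : Layer α w → ℕ → ℕ) (D c : List (Layer α w)) : Data :=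
  encodeEntry encodeKey (key D) (weight stp) encodeLayers c

/-- The successors of the empty set and the list of all pairs of sets of states. -/
def encodeGlobals (α : Type*) [Fintype α] [LinearOrder α] (w : ℕ) : Data :=
  .cons (encodeRows fun _ : α => (∅ : Finset (Fin w))) (.ofList ((statePairs w).map encodePair))

variable {stp : Layer α w → ℕ → ℕ} {D : List (Layer α w)} {W : ℕ}

theorem within_nextEntry {c : List (Layer α w)} {t : ℕ} {globals l l' e : Expr}
    (hB : IsBudget α w B)
    (hstp : Calls (prog main wt) fWeight (.cons (encodeLayer L') (.ofNat (weight stp c)))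
      (.ofNat (stp L' (weight stp c))) t)
    (hglobals : Within (prog main wt) env globals (encodeGlobals α w) 40)
    (hl : Within (prog main wt) env l (encodeLayer L) 40)
    (hl' : Within (prog main wt) env l' (encodeLayer L') 40)
    (he : Within (prog main wt) env e (encodeCandidate stp D c) 40) :
    Within (prog main wt) env (nextEntry globals l l' e) (encodeCandidate stp (L :: D) (L' :: c))
      (B ^ 6 + t + 1000) := by
  rw [encodeCandidate, encodeEntry, key_cons]
  exact .mono (.cons (.cons (within_comp hl' 0) (.cons (within_comp hl' 3)
    (.call (calls_filter L L' hB (key D c)) (.cons (.cons hglobals.fst (.cons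
      (.cons (within_comp hl 2) (within_comp hl' 2))
      (.cons (.cons (within_comp hl 4) (within_comp hl' 4)) he.fst.snd.snd))) hglobals.snd))))
    (.cons (.call hstp (.cons hl' he.snd.fst)) (.cons hl' he.snd.snd))) (by omega)

theorem calls_insertCandidate (hB : IsBudget α w B) {b : List (Layer α w)}
    {ds : List (List (Layer α w))} (hds : (ds.map (key D)).Nodup)
    (hW : ∀ d ∈ ds, weight stp d ≤ W) :
    Calls (prog main wt) fInsert
      (.cons (encodeCandidate stp D b) (.ofList (ds.map (encodeCandidate stp D))))
      (.ofList ((insertLightest (key D) (weight stp) b ds).map (encodeCandidate stp D)))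
      (B ^ 4 * (W + 1)) := by
  have hsize : (encodeKey (key D b)).size ≤ 16 * B ^ 2 :=
    calc (encodeKey (key D b)).size ≤ (8 * w + 4) * (2 ^ w * 2 ^ w + 2) := size_encodeKey_le _
      _ ≤ 8 * B * (2 * B) :=
        Nat.mul_le_mul (by linarith [hB.states_lt]) (by linarith [hB.pairs_lt, hB.const_le])
      _ = 16 * B ^ 2 := by ring
  have hconst : 4096 ≤ B ^ 2 := hB.const_le.trans (Nat.le_self_pow two_ne_zero B)
  exact (calls_insert encodeLayers encodeKey_injective hsize hW).mono
    (fold_time_le hB.const_le (X := B ^ 2 * (W + 1)) (by nlinarith)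
      ((length_le_keyCount hds).trans_lt hB.keys_lt) (by ring))

/-- The function `fWeight` of the program `P` maps `(L, n)` with `n ≤ W` to `stp L n`, in at most
`t` steps. -/
def Weighs (P : Program) (stp : Layer α w → ℕ → ℕ) (W t : ℕ) : Prop :=
  ∀ L n, n ≤ W → Calls P fWeight (.cons (encodeLayer L) (.ofNat n)) (.ofNat (stp L n)) t

theorem calls_extend (hB : IsBudget α w B) (hstp : Weighs (prog main wt) stp W (B ^ 4 * (W + 1)))
    {xs : List (Layer α w × List (Layer α w))} (hxs : xs.length < B * B)
    (hW : ∀ x ∈ xs, weight stp x.2 ≤ W ∧ weight stp (x.1 :: x.2) ≤ W) :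
    Calls (prog main wt) fExtend
      (.cons (.cons (encodeGlobals α w) (encodeLayer L))
        (.ofList (xs.map fun x => .cons (encodeLayer x.1) (encodeCandidate stp D x.2))))
      (.ofList ((lightestPerKey (key (L :: D)) (weight stp) (extensions L xs)).map
        (encodeCandidate stp (L :: D)))) (B ^ 9 * (W + 1)) := by
  have hconst : 4096 ≤ B ^ 6 := hB.const_le.trans (Nat.le_self_pow (by decide) B)
  have hpow : B ^ 4 ≤ B ^ 6 := Nat.pow_le_pow_right (by linarith [hB.const_le]) (by decide)
  refine (Calls.fold (C := 4000 * (B ^ 6 * (W + 1))) rfl _ (fun xs =>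
    .ofList ((lightestPerKey (key (L :: D)) (weight stp) (extensions L xs)).map
      (encodeCandidate stp (L :: D)))) xs (.mono (.access rfl) (by nlinarith))
    fun x xs hx => ?_).mono
    (fold_time_le hB.const_le (X := B ^ 6 * (W + 1)) (by nlinarith) hxs (by ring))
  have hinsert := calls_insertCandidate (main := main) (wt := wt) (W := W) hB (b := x.1 :: x.2)
    (nodup_map_lightestPerKey (κ := key (L :: D)) (μ := weight stp) (bs := extensions L xs))
    fun d hd => by
      obtain ⟨y, hy, rfl⟩ := List.mem_map.1 (mem_of_mem_lightestPerKey hd)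
      exact (hW y (hx.subset (List.mem_cons_of_mem x (List.mem_of_mem_filter hy)))).2
  refine .conv (.ite
    (within_fits (L := L) (L' := x.1) (A := leftFrontier x.2) (.access rfl) (.access rfl)
      (.access rfl))
    (fun _ => .call hinsert (.cons (within_nextEntry hB
      (hstp x.1 (weight stp x.2) (hW x (hx.subset List.mem_cons_self)).1)
      (.access rfl) (.access rfl) (.access rfl) (.access rfl)) (.access rfl)))
    fun _ => .access rfl) ?_ ?_
  · by_cases h : Fits L x.1 (leftFrontier x.2)
    · simp [h, extensions, lightestPerKey]
    · simp [h, extensions]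
  · have hstates : w + 1 ≤ B := hB.states_lt
    have hB6 : 2000 * B ≤ B ^ 6 :=
      calc 2000 * B ≤ B ^ 5 * B := Nat.mul_le_mul_right B
            ((by linarith [hB.const_le] : 2000 ≤ B).trans (Nat.le_self_pow (by decide) B))
        _ = B ^ 6 := by ring
    have hweight : B ^ 6 ≤ B ^ 6 * (W + 1) := Nat.le_mul_of_pos_right _ W.succ_pos
    have hpowWeight := Nat.mul_le_mul_right (W + 1) hpow
    omega

theorem encodeCandidate_nil : encodeCandidate stp ([] : List (Layer α w)) [] =
    .cons (.cons (encodeStates (∅ : Finset (Fin w))) (.cons (encodeStates (∅ : Finset (Fin w)))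
      (.ofList ((statePairs w).map encodePair)))) (.cons .nil .nil) := by
  have h : pairList (key ([] : List (Layer α w)) []).equiv = statePairs w :=
    List.filter_eq_self.2 fun q _ =>
      decide_eq_true (p := q ∈ (key ([] : List (Layer α w)) []).equiv)
        (by simp [key, rlang, Accepts])
  rw [encodeCandidate, encodeEntry, encodeKey, h]
  rfl

variable {l : List (Layer α w)} {k : ℕ}

theorem calls_solve (hB : IsBudget α w B) (hl : l.length < B)
    (hstp : Weighs (prog main wt) stp W (B ^ 4 * (W + 1)))
    (hW : ∀ c, c.length ≤ k → weight stp c ≤ W) (hD : D.length = k) :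
    Calls (prog main wt) fSolve
      (.cons (.cons (.cons (encodeGlobals α w) (encodeLayers l)) (encodeCandidate stp [] []))
        (encodeLayers D))
      (.ofList ((solve stp l D).map (encodeCandidate stp D))) (B ^ 10 * (W + 1) * (k + 1)) := by
  have hconst : 4096 ≤ B ^ 9 * (W + 1) :=
    (hB.const_le.trans (Nat.le_self_pow (by decide) B)).trans (Nat.le_mul_of_pos_right _ W.succ_pos)
  refine (Calls.fold (C := 3 * (B ^ 9 * (W + 1))) rfl encodeLayer
    (fun D => .ofList ((solve stp l D).map (encodeCandidate stp D))) D
    (.mono (.access rfl) (by omega)) fun L D' hsuffix => ?_).mono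
    (fold_time_le hB.const_le (M := k + 1) (X := B ^ 9 * (W + 1)) (by omega)
      (hD.trans_lt k.lt_succ_self) (by ring))
  have hlen := hsuffix.length_le
  have hweight : ∀ x ∈ l.product (solve stp l D'),
      weight stp x.2 ≤ W ∧ weight stp (x.1 :: x.2) ≤ W := fun x hx => by
    have hx := length_of_mem_solve (List.pair_mem_product.1 hx).2
    rw [List.length_cons] at hlen
    exact ⟨hW _ (by omega), hW _ (by rw [List.length_cons]; omega)⟩
  have hproduct : (l.product (solve stp l D')).length < B * B :=
    (List.length_product _ _).trans_lt (Nat.mul_lt_mul_of_lt_of_lt hl (length_solve_lt hB))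
  have hpairs := (calls_pairs (main := main) (wt := wt) encodeLayer (encodeCandidate stp D') l
    (solve stp l D')).mono (pairs_time_le hB (length_solve_lt hB) hl)
  refine .mono (.call (calls_extend hB hstp hproduct hweight)
    (.cons (.access rfl) (.call hpairs (.access rfl)))) ?_
  have hpow : B ^ 3 ≤ B ^ 9 * (W + 1) :=
    (Nat.pow_le_pow_right (by linarith [hB.const_le]) (by decide)).trans
      (Nat.le_mul_of_pos_right _ W.succ_pos)
  omega

/-- The entry of the string of layers `c` without its key. -/
def encodeSolution (stp : Layer α w → ℕ → ℕ) (c : List (Layer α w)) : Data :=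
  encodeEntry (fun _ : Unit => .nil) (fun _ => ()) (weight stp) encodeLayers c

theorem calls_choose (hB : IsBudget α w B) {cs : List (List (Layer α w))} (hcs : cs.length < B)
    (hW : ∀ c ∈ cs, weight stp c ≤ W) :
    Calls (prog main wt) fChoose
      (.cons (encodeStates (firstInit D)) (.ofList (cs.map (encodeCandidate stp D))))
      (.ofList ((lightestPerKey (fun _ => ()) (weight stp) (cs.filter fun c => SameLang D c)).map
        (encodeSolution stp)))
      (B ^ 4 * (W + 1)) := by
  have hconst : 4096 ≤ B ^ 2 := hB.const_le.trans (Nat.le_self_pow two_ne_zero B)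
  have hconstWeight : B ^ 2 ≤ B ^ 2 * (W + 1) := Nat.le_mul_of_pos_right _ W.succ_pos
  refine (Calls.fold (C := 4000 * (B ^ 2 * (W + 1))) rfl _ (fun cs =>
    .ofList ((lightestPerKey (fun _ => ()) (weight stp) (cs.filter fun c => SameLang D c)).map
      (encodeSolution stp))) cs
    (.mono (.access rfl) (by omega)) fun c cs' hsuffix => ?_).mono
    (fold_time_le hB.const_le (X := B ^ 2 * (W + 1)) (by omega) hcs (by ring))
  have hlen := (nodup_map_lightestPerKey (κ := fun _ => ()) (μ := weight stp)
    (bs := cs'.filter fun c => SameLang D c)).length_le_card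
  have hinsert := calls_insert (main := main) (wt := wt) (enc := fun _ : Unit => .nil)
    (κ := fun _ => ()) (μ := weight stp) encodeLayers (fun _ _ _ => rfl) (b := c) (s := 1) (W := W)
    (ds := lightestPerKey (fun _ => ()) (weight stp) (cs'.filter fun c => SameLang D c)) le_rfl
    fun d hd => hW d (hsuffix.subset (List.mem_cons_of_mem c
      (List.mem_of_mem_filter (mem_of_mem_lightestPerKey hd))))
  have hmem : Calls (prog main wt) fMem (.cons (encodePair (firstInit D, firstInit c))
      (.ofList ((pairList (key D c).equiv).map encodePair)))
      (.ofBool (decide (SameLang D c))) (1600 * B ^ 2) := calls_mem_pairList hB _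
  refine .conv (.ite (.call hmem (.access rfl)) (fun _ => .call hinsert (.access rfl))
    fun _ => .access rfl) ?_ ?_
  · by_cases h : SameLang D c
    · rw [if_pos (decide_eq_true h), List.filter_cons, if_pos (decide_eq_true h)]
      rfl
    · rw [if_neg (mt of_decide_eq_true h), List.filter_cons, if_neg (mt of_decide_eq_true h)]
      rfl
  · rw [List.length_map, Fintype.card_unit] at hlen
    have htime := Nat.mul_le_mul_left (200 * 1 + 300 * (W + 1) + 600) (Nat.add_le_add_right hlen 1)
    have hweight : W + 1 ≤ B ^ 2 * (W + 1) := Nat.le_mul_of_pos_left _ (by omega)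
    omega

theorem replicate_nil_eq_encodeStates :
    Data.ofList (List.replicate w .nil) = encodeStates (∅ : Finset (Fin w)) := by
  simp [encodeStates, Data.ofBool]

theorem within_search (hB : IsBudget α w B) (hl : l.length < B)
    (hstp : Weighs (prog main wt) stp W (B ^ 4 * (W + 1)))
    (hW : ∀ c, c.length ≤ k → weight stp c ≤ W) (hD : D.length = k) (hk : 0 < k) :
    Within (prog main wt) [encodeInput D l] search
      (.ofList ((solution stp l D).map (encodeSolution stp))) (B ^ 11 * (W + 1) * (k + 1)) := by
  have hempty := calls_replicate (main := main) (wt := wt) .nil w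
  have hrows := calls_replicate (main := main) (wt := wt) (encodeStates (∅ : Finset (Fin w)))
    (Fintype.card α)
  have hsolve := calls_solve hB hl hstp hW hD
  have hchoose := calls_choose (main := main) (wt := wt) (W := W) (D := D) hB
    (length_solve_lt (stp := stp) (l := l) hB)
    fun c hc => hW c ((length_of_mem_solve hc).trans hD).le
  rw [replicate_nil_eq_encodeStates] at hempty
  rw [← length_letters, ← List.map_const', length_letters] at hrows
  rw [encodeCandidate_nil] at hsolve
  obtain ⟨L, D, rfl⟩ := List.exists_cons_of_length_pos (hk.trans_eq hD.symm)
  refine .mono (.letIn (.call hempty (.access rfl))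
    (.letIn (.call (calls_subsets hB) (.access rfl))
      (.letIn (.call (calls_statePairs hB) (.access rfl))
        (.call hchoose (.cons (.access rfl) (.call hsolve (.cons (.cons (.cons (.cons
          (.call hrows (.access rfl)) (.access rfl)) (.access rfl)) (.access rfl))
          (.access rfl)))))))) ?_
  have hbase : B ^ 4 * (W + 1) ≤ B ^ 10 * (W + 1) * (k + 1) :=
    (Nat.mul_le_mul_right _ (Nat.pow_le_pow_right (by linarith [hB.const_le]) (by decide))).trans
      (Nat.le_mul_of_pos_right _ k.succ_pos)
  have hpow : B ^ 3 ≤ B ^ 4 * (W + 1) :=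
    (Nat.pow_le_pow_right (by linarith [hB.const_le]) (by decide)).trans
      (Nat.le_mul_of_pos_right _ W.succ_pos)
  calc _ ≤ 1000 * (B ^ 10 * (W + 1) * (k + 1)) := by
        linarith [hB.const_le, hB.states_lt, hB.letters_lt, Nat.le_self_pow three_ne_zero B]
    _ ≤ B * (B ^ 10 * (W + 1) * (k + 1)) := Nat.mul_le_mul_right _ (by linarith [hB.const_le])
    _ = B ^ 11 * (W + 1) * (k + 1) := by ring

end Search

/-! ### The three measures as weights -/

section Measures

variable {c : List (Layer α w)} {k : ℕ}

/-- The step of the weight that is the width of diagrams. -/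
def widthStep (L : Layer α w) (n : ℕ) : ℕ := max n (max L.left.card L.right.card)

/-- The step of the weight that is the number of states of diagrams; the left frontier only counts
in the first layer, where it is not the right frontier of another layer. -/
def stateStep (L : Layer α w) (n : ℕ) : ℕ :=
  L.right.card + if L.initFlag then L.left.card + n else n

/-- The step of the weight that is the number of transitions. -/
def transitionStep (L : Layer α w) (n : ℕ) : ℕ := L.trans.card + n

theorem monotone_widthStep (L : Layer α w) : Monotone (widthStep L) :=
  fun _ _ h => max_le_max_right _ h

theorem monotone_stateStep (L : Layer α w) : Monotone (stateStep L) := fun a b h => by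
  unfold stateStep
  split_ifs <;> omega

theorem monotone_transitionStep (L : Layer α w) : Monotone (transitionStep L) :=
  fun _ _ h => Nat.add_le_add_left h _

theorem weight_widthStep_le (c : List (Layer α w)) : weight widthStep c ≤ w := by
  induction c with
  | nil => exact w.zero_le
  | cons L c ih => exact max_le ih (max_le (card_finset_fin_le _) (card_finset_fin_le _))

theorem stateStep_le (L : Layer α w) (n : ℕ) : stateStep L n ≤ 2 * w + n := by
  have hleft := card_finset_fin_le L.left
  have hright := card_finset_fin_le L.right
  unfold stateStep
  split_ifs <;> omega

theorem transitionStep_le [Fintype α] (L : Layer α w) (n : ℕ) :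
    transitionStep L n ≤ w * (Fintype.card α * w) + n :=
  Nat.add_le_add_right (L.trans.card_le_univ.trans_eq (by simp)) n

theorem weight_le {stp : Layer α w → ℕ → ℕ} {C : ℕ} (h : ∀ L n, stp L n ≤ C + n)
    (hc : c.length ≤ k) : weight stp c ≤ C * k := by
  refine le_trans ?_ (Nat.mul_le_mul_left C hc)
  clear hc
  induction c with
  | nil => exact Nat.zero_le _
  | cons L c ih =>
    calc weight stp (L :: c) ≤ C + weight stp c := h L _
      _ ≤ C + C * c.length := by gcongr
      _ = C * (c.length + 1) := by ring

theorem weight_widthStep (hc : c.IsChain fun L L' => L'.left = L.right) :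
    weight widthStep c = width c := by
  induction c with
  | nil => rfl
  | cons L c ih =>
    cases c with
    | nil => simp [weight, width, widthStep]
    | cons M c =>
      rw [List.isChain_cons_cons] at hc
      have h := ih hc.2
      simp only [weight, width, widthStep, List.foldr_cons, List.map_cons,
        List.getLast?_cons_cons] at h ⊢
      rw [h, ← hc.1]
      omega

theorem weight_transitionStep (c : List (Layer α w)) :
    weight transitionStep c = numTransitions c := by
  rw [weight, numTransitions, List.sum_eq_foldr, List.foldr_map]
  rfl

theorem weight_stateStep_of_initFlag_eq_false (h : ∀ L ∈ c, L.initFlag = false) :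
    weight stateStep c = (c.map fun L => L.right.card).sum := by
  induction c with
  | nil => rfl
  | cons L c ih =>
    rw [List.map_cons, List.sum_cons, ← ih fun M hM => h M (List.mem_cons_of_mem L hM)]
    simp [weight, stateStep, h L List.mem_cons_self]

theorem weight_stateStep (hc : IsODD c) : weight stateStep c = numStates c := by
  obtain ⟨L, c, rfl⟩ := List.exists_cons_of_ne_nil hc.ne_nil
  have hhead : L.initFlag = true := (hc.initFlag 0 (by simp)).2 rfl
  have htail : ∀ M ∈ c, M.initFlag = false := fun M hM => by
    obtain ⟨i, hi, rfl⟩ := List.getElem_of_mem hM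
    have hflag := hc.initFlag (i + 1) (by simpa using hi)
    rw [List.getElem_cons_succ] at hflag
    simpa using hflag
  have hsum := weight_stateStep_of_initFlag_eq_false htail
  rw [weight] at hsum
  simp only [weight, numStates, List.foldr_cons, hsum, stateStep, hhead, if_true, List.head?_cons,
    Option.map_some, Option.getD_some, List.map_cons, List.sum_cons]
  omega

theorem IsMinimizer.congr {μ ν : List (Layer α w) → ℕ} {S : Set (Layer α w)}
    {D D' : List (Layer α w)} (h : IsMinimizer μ S D D') (hμν : ∀ c, IsODD c → μ c = ν c) :
    IsMinimizer ν S D D' := by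
  refine ⟨h.1, h.2.1, fun c hc hlang => ?_⟩
  have hle := h.2.2 c hc hlang
  obtain ⟨_, _, hD', -⟩ := h.1
  obtain ⟨_, _, hc, -⟩ := hc
  rwa [hμν _ hD', hμν _ hc] at hle

end Measures

/-! ### Running times of the weight functions -/

namespace Prog

/-- Computes `widthStep`. -/
def widthBody : Expr :=
  .call fMax (.cons (.snd arg) (.call fMax (.cons
    (.call fCount (.cons .nil (comp (.fst arg) 0)))
    (.call fCount (.cons .nil (comp (.fst arg) 1))))))

/-- Computes `stateStep`. -/
def stateBody : Expr :=
  .call fCount (.cons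
    (.ite (comp (.fst arg) 5) (.call fCount (.cons (.snd arg) (comp (.fst arg) 0))) (.snd arg))
    (comp (.fst arg) 1))

/-- Computes `transitionStep`. -/
def transitionBody : Expr :=
  .call fCountTable (.cons (.snd arg) (comp (.fst arg) 2))

end Prog

section MeasureFunctions

variable {main wt : Expr} {ι κ ν : Type*} {A : Finset (Fin w)} {B W : ℕ}

theorem calls_count (f : ι → Bool) (qs : List ι) (n : ℕ) :
    Calls (prog main wt) fCount (.cons (.ofNat n) (bits f qs)) (.ofNat (qs.countP f + n))
      (300 * (qs.length + 1)) := by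
  refine .fold rfl _ (fun qs => .ofNat (qs.countP f + n)) qs
    (.conv (.access rfl) (by simp [Data.fst]) (by simp)) fun q qs _ => ?_
  refine .conv (.ite (q := f q) (.access rfl) (fun _ => .access rfl) fun _ => .access rfl)
    ?_ (by simp)
  cases h : f q
  · simp [h]
  · simp only [if_true, List.countP_cons_of_pos h, Nat.add_right_comm _ 1 n]
    rfl

theorem calls_countRows (F : κ → ι → Bool) (qs : List ι) (as : List κ) (n : ℕ) :
    Calls (prog main wt) fCountRows
      (.cons (.ofNat n) (.ofList (as.map fun a => bits (F a) qs)))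
      (.ofNat ((as.map fun a => qs.countP (F a)).sum + n))
      ((300 * (qs.length + 1) + 300) * (as.length + 1)) := by
  refine .fold rfl _ (fun as => .ofNat ((as.map fun a => qs.countP (F a)).sum + n)) as
    (.conv (.access rfl) (by simp [Data.fst]) (by omega)) fun a as _ => ?_
  exact .conv (.call (calls_count (F a) qs _) (.cons (.access rfl) (.access rfl)))
    (by rw [List.map_cons, List.sum_cons, add_assoc]) (by omega)

theorem calls_countTable (F : ν → κ → ι → Bool) (qs : List ι) (as : List κ) (ps : List ν) (n : ℕ) :
    Calls (prog main wt) fCountTable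
      (.cons (.ofNat n) (.ofList (ps.map fun p => .ofList (as.map fun a => bits (F p a) qs))))
      (.ofNat ((ps.map fun p => (as.map fun a => qs.countP (F p a)).sum).sum + n))
      (((300 * (qs.length + 1) + 300) * (as.length + 1) + 300) * (ps.length + 1)) := by
  refine .fold rfl _
    (fun ps => .ofNat ((ps.map fun p => (as.map fun a => qs.countP (F p a)).sum).sum + n)) ps
    (.conv (.access rfl) (by simp [Data.fst]) (by omega)) fun p ps _ => ?_
  exact .conv (.call (calls_countRows (F p) qs as _) (.cons (.access rfl) (.access rfl)))
    (by rw [List.map_cons, List.sum_cons, add_assoc]) (by omega)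

theorem calls_max (m n : ℕ) :
    Calls (prog main wt) fMax (.cons (.ofNat m) (.ofNat n)) (.ofNat (max m n))
      (300 * (n + 1) + 200) := by
  have hsub : Within (prog main wt) [.cons (.ofNat m) (.ofNat n)] (.call fSub arg)
      (.ofNat (m - n)) (300 * (n + 1) + 41) :=
    .mono (.call (calls_sub m n) (.access rfl)) (by omega)
  cases h : m - n with
  | zero =>
    rw [h] at hsub
    rw [max_eq_right (by omega)]
    exact .intro (e := maxBody) rfl (.mono (.iteNil hsub (.access rfl)) (by omega))
  | succ d =>
    rw [h] at hsub
    rw [max_eq_left (by omega)]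
    exact .intro (e := maxBody) rfl (.mono (.iteCons hsub (.access rfl)) (by omega))

theorem countP_finRange (A : Finset (Fin w)) :
    (List.finRange w).countP (fun p => decide (p ∈ A)) = A.card := by
  rw [List.countP_eq_length_filter,
    ← List.toFinset_card_of_nodup ((List.nodup_finRange w).filter _)]
  congr 1
  ext
  simp

theorem calls_card (A : Finset (Fin w)) (n : ℕ) :
    Calls (prog main wt) fCount (.cons (.ofNat n) (encodeStates A)) (.ofNat (A.card + n))
      (300 * (w + 1)) := by
  have h := calls_count (main := main) (wt := wt) (fun p => decide (p ∈ A)) (List.finRange w) n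
  rwa [countP_finRange, List.length_finRange] at h

theorem weighs_widthStep [Fintype α] [LinearOrder α] (hB : IsBudget α w B) :
    Weighs (prog main widthBody) (widthStep (α := α) (w := w)) W (B ^ 4 * (W + 1)) := by
  intro L n _
  have hconst := mul_le_pow_four hB.const_le
  have hw := hB.states_lt
  have hleft := card_finset_fin_le L.left
  have hright := card_finset_fin_le L.right
  have harg : Within (prog main widthBody) [.cons (encodeLayer L) (.ofNat n)] (.fst arg)
      (encodeLayer L) 40 := .access rfl
  refine .intro rfl (.mono (.call (calls_max n _) (.cons (.access rfl) (.call (calls_max _ _) (.cons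
    (.call (calls_card L.left 0) (.cons (.access rfl) (within_comp harg 0)))
    (.call (calls_card L.right 0) (.cons (.access rfl) (within_comp harg 1))))))) ?_)
  refine .trans ?_ (Nat.le_mul_of_pos_right _ W.succ_pos)
  linarith [max_le hleft hright]

theorem weighs_stateStep [Fintype α] [LinearOrder α] (hB : IsBudget α w B) :
    Weighs (prog main stateBody) (stateStep (α := α) (w := w)) W (B ^ 4 * (W + 1)) := by
  intro L n _
  have harg : Within (prog main stateBody) [.cons (encodeLayer L) (.ofNat n)] (.fst arg)
      (encodeLayer L) 40 := .access rfl
  refine .intro rfl (.conv (.call (calls_card L.right (if L.initFlag then L.left.card + n else n))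
    (.cons (.conv (.ite (q := L.initFlag) (within_comp harg 5)
      (fun _ => .call (calls_card L.left n) (.cons (.access rfl) (within_comp harg 0)))
      fun _ => .access rfl) (apply_ite Data.ofNat _ _ _).symm le_rfl) (within_comp harg 1))) rfl ?_)
  refine .trans ?_ (Nat.le_mul_of_pos_right _ W.succ_pos)
  rw [max_eq_left (by omega)]
  linarith [mul_le_pow_four hB.const_le, hB.states_lt, hB.const_le]

theorem sum_map_letters [Fintype α] [LinearOrder α] (f : α → ℕ) :
    ((letters α).map f).sum = ∑ a, f a := by
  rw [letters, ← List.sum_toFinset f (Finset.sort_nodup _ _)]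
  simp

theorem card_eq_sum_countP [Fintype α] [LinearOrder α] (T : Finset (Fin w × α × Fin w)) :
    ((List.finRange w).map fun p => ((letters α).map fun a =>
      (List.finRange w).countP fun q => decide ((p, a, q) ∈ T)).sum).sum = T.card := by
  have hcount (p : Fin w) (a : α) : (List.finRange w).countP (fun q => decide ((p, a, q) ∈ T)) =
      ∑ q, if (p, a, q) ∈ T then 1 else 0 := by
    rw [Finset.sum_boole, Nat.cast_id, ← countP_finRange]
    simp
  have hcard : T.card = ∑ x, if x ∈ T then 1 else 0 := by
    rw [← Finset.card_filter, Finset.filter_univ_mem]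
  simp only [hcount, sum_map_letters, ← Fin.sum_univ_def, hcard, Fintype.sum_prod_type]

theorem weighs_transitionStep [Fintype α] [LinearOrder α] (hB : IsBudget α w B) :
    Weighs (prog main transitionBody) (transitionStep (α := α) (w := w)) W (B ^ 4 * (W + 1)) := by
  intro L n _
  have harg : Within (prog main transitionBody) [.cons (encodeLayer L) (.ofNat n)] (.fst arg)
      (encodeLayer L) 40 := .access rfl
  have hcount := calls_countTable (main := main) (wt := transitionBody)
    (fun p a q => decide ((p, a, q) ∈ L.trans)) (List.finRange w) (letters α) (List.finRange w) n
  rw [card_eq_sum_countP] at hcount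
  refine .intro rfl (.mono (.call hcount (.cons (.access rfl) (within_comp harg 2))) ?_)
  refine .trans ?_ (Nat.le_mul_of_pos_right _ W.succ_pos)
  rw [List.length_finRange, length_letters]
  have hrow : (300 * (w + 1) + 300) * (Fintype.card α + 1) + 400 ≤
      (500 * (w + 1) + 500) * (Fintype.card α + 1) + 400 := by gcongr <;> norm_num
  nlinarith [post_time_le hB]

end MeasureFunctions

/-! ### Total running times -/

section Budget

/-- The power of two of which fixed powers bound the factors of all running times that only depend
on the alphabet and on the number `w` of states. -/
def budget (α : Type*) [Fintype α] (w : ℕ) : ℕ := 2 ^ (6 * (Fintype.card α * w * 2 ^ w))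

variable [Fintype α]

theorem budget_pow (n : ℕ) :
    budget α w ^ n = 2 ^ (6 * n * (Fintype.card α * w * 2 ^ w)) := by
  rw [budget, ← pow_mul]
  ring_nf

theorem lt_budget {a e : ℕ} (ha : a ≤ 2 ^ e)
    (he : e + 1 ≤ 6 * (Fintype.card α * w * 2 ^ w)) : a < budget α w :=
  calc a ≤ 2 ^ e := ha
    _ < 2 ^ (e + 1) := Nat.pow_lt_pow_right one_lt_two e.lt_succ_self
    _ ≤ budget α w := Nat.pow_le_pow_right two_pos he

theorem length_le_of_nodup {l : List (Layer α w)} (hl : l.Nodup) :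
    l.length ≤ 2 ^ (4 * w + 2 + w * (Fintype.card α * w)) := by
  let components (L : Layer α w) : (Finset (Fin w) × Finset (Fin w) × Finset (Fin w) ×
      Finset (Fin w)) × (Bool × Bool) × Finset (Fin w × α × Fin w) :=
    ((L.left, L.right, L.init, L.fin), (L.initFlag, L.finFlag), L.trans)
  have hinj : Function.Injective components := fun L L' h => by
    simp only [components, Prod.mk.injEq] at h
    ext1 <;> tauto
  have hcard := (hl.map hinj).length_le_card
  rw [List.length_map] at hcard
  refine hcard.trans_eq ?_
  simp only [Fintype.card_prod, Fintype.card_finset, Fintype.card_fin, Fintype.card_bool]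
  rw [pow_add, pow_add, pow_mul']
  ring

variable [Nonempty α]

theorem states_mul_two_pow_le : w * 2 ^ w ≤ Fintype.card α * w * 2 ^ w := by
  rw [mul_assoc]
  exact Nat.le_mul_of_pos_left _ Fintype.card_pos

theorem two_le_two_pow (hw : 0 < w) : 2 ≤ 2 ^ w := Nat.le_self_pow hw.ne' 2

theorem isBudget_budget (hw : 0 < w) : IsBudget α w (budget α w) := by
  have hX := states_mul_two_pow_le (α := α) (w := w)
  have hpow : 2 ^ w ≤ w * 2 ^ w := Nat.le_mul_of_pos_left _ hw
  have hstates : w * 2 ≤ w * 2 ^ w := Nat.mul_le_mul_left w (two_le_two_pow hw)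
  have hletters : Fintype.card α ≤ Fintype.card α * w * 2 ^ w := by
    rw [mul_assoc]
    exact Nat.le_mul_of_pos_right _ (by positivity)
  constructor
  · exact Nat.pow_le_pow_right (i := 12) two_pos (by omega)
  · exact lt_budget Nat.lt_two_pow_self.le (by omega)
  · exact lt_budget Nat.lt_two_pow_self.le (by omega)
  · exact lt_budget (pow_add 2 w w).ge (by omega)
  · refine lt_budget (e := w + (w + (w + 1) * 2 ^ w)) ?_ (by rw [Nat.succ_mul]; omega)
    rw [keyCount, pow_add, pow_add, pow_mul]
    gcongr
    rw [pow_succ]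
    linarith [two_le_two_pow hw]

theorem length_lt_budget {l : List (Layer α w)} (hw : 0 < w) (hl : l.Nodup) :
    l.length < budget α w := by
  have hX := states_mul_two_pow_le (α := α) (w := w)
  have hstates : w * 2 ≤ w * 2 ^ w := Nat.mul_le_mul_left w (two_le_two_pow hw)
  have htrans : w * (Fintype.card α * w) ≤ Fintype.card α * w * 2 ^ w := by
    rw [Nat.mul_comm]
    exact Nat.mul_le_mul_left _ Nat.lt_two_pow_self.le
  exact lt_budget (length_le_of_nodup hl) (by omega)

end Budget

section Main

variable {main wt : Expr} [Fintype α] [LinearOrder α] [Nonempty α] {C k m : ℕ}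
  {stp : Layer α w → ℕ → ℕ} {D l : List (Layer α w)} {S : Set (Layer α w)}

theorem search_time_le {B : ℕ} (hB : 4096 ≤ B) (hk : 0 < k) (hm : 0 < m) (hC : C < B ^ 3) :
    B ^ 11 * (C * m + 1) * (k + 1) + 41 ≤ B ^ 16 * (m * k) := by
  have hweight : C * m + 1 ≤ B ^ 3 * m :=
    calc C * m + 1 ≤ (C + 1) * m := by linarith
      _ ≤ B ^ 3 * m := Nat.mul_le_mul_right m hC
  have hpos : 0 < B ^ 14 * (m * k) := by positivity
  calc B ^ 11 * (C * m + 1) * (k + 1) + 41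
      ≤ B ^ 11 * (B ^ 3 * m) * (2 * k) + 41 * (B ^ 14 * (m * k)) := by gcongr <;> omega
    _ = 43 * (B ^ 14 * (m * k)) := by ring
    _ ≤ B ^ 2 * (B ^ 14 * (m * k)) := by gcongr; nlinarith
    _ = B ^ 16 * (m * k) := by ring

theorem within_search_budget (hw : 0 < w) (hk : 0 < k) (hD : D ∈ oddsOfLength Set.univ k)
    (hl : Presents l S)
    (hstp : Weighs (prog main wt) stp (C * m) (budget α w ^ 4 * (C * m + 1)))
    (hweight : ∀ c, c.length ≤ k → weight stp c ≤ C * m) (hm : 0 < m) (hC : C < budget α w ^ 3) :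
    ∃ t, t + 41 ≤ budget α w ^ 16 * (m * k) ∧ Within (prog main wt) [encodeInput D l] search
      (.ofList ((solution stp l D).map (encodeSolution stp))) t :=
  ⟨_, search_time_le (isBudget_budget hw).const_le hk hm hC,
    within_search (isBudget_budget hw) (length_lt_budget hw hl.1) hstp hweight hD.2.1 hk⟩

theorem exists_outputsWithin_decide (hw : 0 < w) (hk : 0 < k) (hD : D ∈ oddsOfLength Set.univ k)
    (hl : Presents l S) :
    ∃ b : Bool, (b = true ↔ ∃ D' ∈ oddsOfLength S k, lang D' = lang D) ∧
      (prog decideBody widthBody).OutputsWithin (encodeInput D l) (.ofBool b)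
        (budget α w ^ 16 * k) := by
  have hB := isBudget_budget (α := α) hw
  obtain ⟨t, ht, hsearch⟩ := within_search_budget hw hk hD hl (weighs_widthStep hB)
    (fun c _ => (weight_widthStep_le c).trans_eq (mul_one w).symm) one_pos
    (hB.states_lt.trans_le (Nat.le_self_pow three_ne_zero _))
  rw [one_mul] at ht
  have hsolution := solution_ne_nil_iff hk monotone_widthStep hl.2 hD
  cases h : solution widthStep l D with
  | nil =>
    rw [h] at hsearch hsolution
    exact ⟨false, by simpa using hsolution, (hsearch.iteNil (.access rfl)).mono ht⟩
  | cons c cs =>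
    rw [h] at hsearch hsolution
    exact ⟨true, by simpa using hsolution, (hsearch.iteCons (.access rfl)).mono ht⟩

theorem exists_outputsWithin_optimum {μ : List (Layer α w) → ℕ} (hmono : ∀ L, Monotone (stp L))
    (hμ : ∀ c, IsODD c → weight stp c = μ c) (hw : 0 < w) (hk : 0 < k)
    (hD : D ∈ oddsOfLength Set.univ k) (hl : Presents l S)
    (hstp : Weighs (prog optimumBody wt) stp (C * m) (budget α w ^ 4 * (C * m + 1)))
    (hweight : ∀ c, c.length ≤ k → weight stp c ≤ C * m) (hm : 0 < m) (hC : C < budget α w ^ 3)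
    (h : ∃ D' ∈ oddsOfLength S k, lang D' = lang D) :
    ∃ D', IsMinimizer μ S D D' ∧
      (prog optimumBody wt).OutputsWithin (encodeInput D l) (encodeLayers D')
        (budget α w ^ 16 * (m * k)) := by
  obtain ⟨c, cs, hc⟩ := List.exists_cons_of_ne_nil
    ((solution_ne_nil_iff hk hmono hl.2 hD).2 h)
  obtain ⟨t, ht, hsearch⟩ := within_search_budget hw hk hD hl hstp hweight hm hC
  rw [hc] at hsearch
  have hmin := (isMinimizer_of_mem_solution hk hmono hl.2 hD (hc ▸ List.mem_cons_self)).2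
  exact ⟨c, hmin.congr hμ, hsearch.fst.snd.snd.mono (by omega)⟩

end Main

/-- Some program decides whether a given diagram of length `k` has the language of a diagram with
layers in a given set, in time `2 ^ O(|Σ| * w * 2 ^ w) * T k`. -/
def DecidableWithin (T : ℕ → ℕ) : Prop :=
  ∃ (P : Program) (c : ℕ),
    ∀ (α : Type u) [Fintype α] [LinearOrder α] [Nonempty α] (w k : ℕ), 0 < w → 0 < k →
    ∀ D ∈ oddsOfLength (Set.univ : Set (Layer α w)) k,
    ∀ (S : Set (Layer α w)) (l : List (Layer α w)), Presents l S →
    ∃ b : Bool, (b = true ↔ ∃ D' ∈ oddsOfLength S k, lang D' = lang D) ∧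
      P.OutputsWithin (encodeInput D l) (.ofBool b)
        (2 ^ (c * (Fintype.card α * w * 2 ^ w)) * T k)

/-- Some program finds a diagram that minimizes `μ` among the diagrams with layers in a given set
and the language of a given diagram of length `k`, if there is one of length `k`, in time
`2 ^ O(|Σ| * w * 2 ^ w) * T k`. -/
def MinimizableWithin (μ : ∀ {α : Type u} {w : ℕ}, List (Layer α w) → ℕ) (T : ℕ → ℕ) : Prop :=
  ∃ (P : Program) (c : ℕ),
    ∀ (α : Type u) [Fintype α] [LinearOrder α] [Nonempty α] (w k : ℕ), 0 < w → 0 < k →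
    ∀ D ∈ oddsOfLength (Set.univ : Set (Layer α w)) k,
    ∀ (S : Set (Layer α w)) (l : List (Layer α w)), Presents l S →
    (∃ D' ∈ oddsOfLength S k, lang D' = lang D) →
    ∃ D', IsMinimizer μ S D D' ∧
      P.OutputsWithin (encodeInput D l) (encodeLayers D')
        (2 ^ (c * (Fintype.card α * w * 2 ^ w)) * T k)

theorem MinimizableWithin.mono {μ : ∀ {α : Type u} {w : ℕ}, List (Layer α w) → ℕ} {T T' : ℕ → ℕ}
    (h : MinimizableWithin μ T) (hT : ∀ k, 0 < k → T k ≤ T' k) : MinimizableWithin μ T' := by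
  obtain ⟨P, c, h⟩ := h
  refine ⟨P, c, fun α _ _ _ w k hw hk D hD S l hl hex => ?_⟩
  obtain ⟨D', hmin, hP⟩ := h α w k hw hk D hD S l hl hex
  exact ⟨D', hmin, Within.mono hP (Nat.mul_le_mul_left _ (hT k hk))⟩

theorem decidableWithin_linear : DecidableWithin.{u} fun k => k := by
  refine ⟨prog decideBody widthBody, 96, fun α _ _ _ w k hw hk D hD S l hl => ?_⟩
  have h := exists_outputsWithin_decide hw hk hD hl
  rwa [budget_pow] at h

theorem minimizableWithin_width : MinimizableWithin.{u} width fun k => k := by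
  refine ⟨prog optimumBody widthBody, 96, fun α _ _ _ w k hw hk D hD S l hl hex => ?_⟩
  have hB := isBudget_budget (α := α) hw
  have h := exists_outputsWithin_optimum monotone_widthStep
    (fun c hc => weight_widthStep hc.frontier) hw hk hD hl (weighs_widthStep hB)
    (fun c _ => (weight_widthStep_le c).trans_eq (mul_one w).symm) one_pos
    (hB.states_lt.trans_le (Nat.le_self_pow three_ne_zero _)) hex
  rwa [budget_pow, one_mul] at h

theorem minimizableWithin_numStates : MinimizableWithin.{u} numStates fun k => k ^ 2 := by
  refine ⟨prog optimumBody stateBody, 96, fun α _ _ _ w k hw hk D hD S l hl hex => ?_⟩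
  have hB := isBudget_budget (α := α) hw
  have hC : 2 * w < budget α w ^ 3 :=
    calc 2 * w < budget α w ^ 2 := by nlinarith [hB.states_lt, hB.const_le]
      _ ≤ budget α w ^ 3 := Nat.pow_le_pow_right (by linarith [hB.const_le]) (by decide)
  have h := exists_outputsWithin_optimum monotone_stateStep (fun c => weight_stateStep) hw hk hD hl
    (weighs_stateStep hB) (fun c hc => weight_le stateStep_le hc) hk hC hex
  rwa [budget_pow, ← sq] at h

theorem minimizableWithin_numTransitions :
    MinimizableWithin.{u} numTransitions fun k => k ^ 2 := by
  refine ⟨prog optimumBody transitionBody, 96, fun α _ _ _ w k hw hk D hD S l hl hex => ?_⟩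
  have hB := isBudget_budget (α := α) hw
  have hC : w * (Fintype.card α * w) < budget α w ^ 3 :=
    calc w * (Fintype.card α * w) < budget α w * (budget α w * budget α w) :=
          Nat.mul_lt_mul'' hB.states_lt (Nat.mul_lt_mul'' hB.letters_lt hB.states_lt)
      _ = budget α w ^ 3 := by ring
  have h := exists_outputsWithin_optimum monotone_transitionStep
    (fun c _ => weight_transitionStep c) hw hk hD hl (weighs_transitionStep hB)
    (fun c hc => weight_le transitionStep_le hc) hk hC hex
  rwa [budget_pow, ← sq] at h

end

end ODD

open ODD in
theorem theorem5p4_general :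
    DecidableWithin.{u} (fun k => k) ∧ MinimizableWithin.{u} width (fun k => k) ∧
      MinimizableWithin.{u} numStates (fun k => k ^ 2) ∧
      MinimizableWithin.{u} numTransitions (fun k => k ^ 2) :=
  ⟨decidableWithin_linear, minimizableWithin_width, minimizableWithin_numStates,
    minimizableWithin_numTransitions⟩

theorem theorem5p4 :
    -- deciding whether there is a diagram with layers in `S` and the same language
    (∃ (P : ODD.Program) (c : ℕ),
      ∀ (α : Type u) [Fintype α] [LinearOrder α] [Nonempty α] (w k : ℕ), 0 < w → 0 < k →
      ∀ D ∈ ODD.oddsOfLength (Set.univ : Set (ODD.Layer α w)) k,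
      ∀ (S : Set (ODD.Layer α w)) (l : List (ODD.Layer α w)), ODD.Presents l S →
      ∃ b : Bool, (b = true ↔ ∃ D' ∈ ODD.oddsOfLength S k, ODD.lang D' = ODD.lang D) ∧
        P.OutputsWithin (ODD.encodeInput D l) (.ofBool b)
          (2 ^ (c * (Fintype.card α * w * 2 ^ w)) * k)) ∧
    -- minimum width
    (∃ (P : ODD.Program) (c : ℕ),
      ∀ (α : Type u) [Fintype α] [LinearOrder α] [Nonempty α] (w k : ℕ), 0 < w → 0 < k →
      ∀ D ∈ ODD.oddsOfLength (Set.univ : Set (ODD.Layer α w)) k,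
      ∀ (S : Set (ODD.Layer α w)) (l : List (ODD.Layer α w)), ODD.Presents l S →
      (∃ D' ∈ ODD.oddsOfLength S k, ODD.lang D' = ODD.lang D) →
      ∃ D', ODD.IsMinimizer ODD.width S D D' ∧
        P.OutputsWithin (ODD.encodeInput D l) (ODD.encodeLayers D')
          (2 ^ (c * (Fintype.card α * w * 2 ^ w)) * k)) ∧
    -- minimum number of states
    (∃ (P : ODD.Program) (c : ℕ),
      ∀ (α : Type u) [Fintype α] [LinearOrder α] [Nonempty α] (w k : ℕ), 0 < w → 0 < k →
      ∀ D ∈ ODD.oddsOfLength (Set.univ : Set (ODD.Layer α w)) k,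
      ∀ (S : Set (ODD.Layer α w)) (l : List (ODD.Layer α w)), ODD.Presents l S →
      (∃ D' ∈ ODD.oddsOfLength S k, ODD.lang D' = ODD.lang D) →
      ∃ D', ODD.IsMinimizer ODD.numStates S D D' ∧
        P.OutputsWithin (ODD.encodeInput D l) (ODD.encodeLayers D')
          (2 ^ (c * (Fintype.card α * w * 2 ^ w)) * (k ^ 2 * Nat.log 2 (k + 1)))) ∧
    -- minimum number of transitions
    (∃ (P : ODD.Program) (c : ℕ),
      ∀ (α : Type u) [Fintype α] [LinearOrder α] [Nonempty α] (w k : ℕ), 0 < w → 0 < k →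
      ∀ D ∈ ODD.oddsOfLength (Set.univ : Set (ODD.Layer α w)) k,
      ∀ (S : Set (ODD.Layer α w)) (l : List (ODD.Layer α w)), ODD.Presents l S →
      (∃ D' ∈ ODD.oddsOfLength S k, ODD.lang D' = ODD.lang D) →
      ∃ D', ODD.IsMinimizer ODD.numTransitions S D D' ∧
        P.OutputsWithin (ODD.encodeInput D l) (ODD.encodeLayers D')
          (2 ^ (c * (Fintype.card α * w * 2 ^ w)) * (k ^ 2 * Nat.log 2 (k + 1)))) := by
  have hlog (k : ℕ) (hk : 0 < k) : k ^ 2 ≤ k ^ 2 * Nat.log 2 (k + 1) :=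
    Nat.le_mul_of_pos_right _ (Nat.log_pos one_lt_two (by omega))
  obtain ⟨hdecide, hwidth, hstates, htransitions⟩ := theorem5p4_general.{u}
  exact ⟨hdecide, hwidth, hstates.mono hlog, htransitions.mono hlog⟩
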